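/- **Proposition 1.1.** Let $\mathbb K=\mathbb R$ ($C^\infty$ category) or $\mathbb K=\mathbb C$ (holomorphic category), let $0\le r\le n$ and $m'\ge 0$ be integers, and let $a_1,\dots,a_{n-r},a\in\mathbb K$ be pairwise distinct non-zero scalars. *Veronese web.* Let $N\subset\mathbb K^n$ be open, with coordinates $x=(x_1,\dots,x_n)$, and let $J$ be the $(1,1)$-tensor field with $dx_j\circ J=a_jdx_j$ for $j\le n-r$ and $dx_j\circ J=a\,dx_j$ for $j>n-r$. Let $\alpha_1,\dots,\alpha_r$ be closed $1$-forms on $N$, linearly independent at every point, with $\alpha_1\wedge\dots\wedge\alpha_r\wedge d(\alpha_k\circ J)=0$ for $k=1,\dots,r$, and such that at every point $\bigcap_k\ker\alpha_k$ contains no non-zero $J$-invariant subspace (so $\alpha_1,\dots,\alpha_r$ and $J$ define a Veronese web $w(t)=(J+tI)\bigcap_k\ker\alpha_k$, $w(\infty)=\bigcap_k\ker\alpha_k$). *Local model.* Let $M$ be an open set of $\mathbb K^{n}\times\mathbb K^{n-r}\times\mathbb K^{2m'}$ with coordinates $(x_1,\dots,x_n,y_1,\dots,y_{n-r},z_1,\dots,z_{2m'})$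 whose projection to the $x$-space lies in $N$, and let $P$ be an open set of the $(x,z)$-space containing the projection of $M$. Let $(y_{n-r+1},\dots,y_n)$ be the canonical coordinates of $\mathbb K^r$. On $M\times\mathbb K^r$ put $$\Omega=\sum_{j=1}^n dx_j\wedge dy_j+\sum_{k=1}^{m'}dz_{2k-1}\wedge dz_{2k},\qquad \Omega_1=\sum_{j=1}^{n-r}a_jdx_j\wedge dy_j+\sum_{j=n-r+1}^{n}a\,dx_j\wedge dy_j+\Omega_1',$$ where $\Omega'_1$ is the pull-back of a $2$-form on $P$ (that is, it has no term in $dy_1,\dots,dy_n$ and its coefficients do not depend on $y$), and assume that $\Omega_1$ is closed and nondegenerate on $M\times\mathbb K^r$. Let $H$ be the $(1,1)$-tensor field with $\Omega_1(X,Y)=\Omega(HX,Y)$, and let $\Omega_2(X,Y)=\Omega(H^2X,Y)$. Forms on $N$ are also regarded as forms on $M$ and on $M\times\mathbb K^r$ by pull-back, and $M$ is identified with $M\times\{0\}\subset M\times\mathbb K^r$. Let $\Lambda$ be the bivector field on $M$ given by $\alpha_1\circ J^{-1},\dots,\alpha_r\circ J^{-1}$ and $\Omega|_M$, and $\Lambda_1$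 the one given by $\alpha_1,\dots,\alpha_r$ and $\Omega_1|_M$. Here the bivector field given by $1$-forms $\eta_1,\dots,\eta_r$ and a $2$-form $\sigma$ that is nondegenerate on $D=\bigcap_k\ker\eta_k$ sends a covector $\xi$ to the unique vector $\Lambda(\xi,\cdot)\in D$ with $\sigma(\Lambda(\xi,\cdot),Y)=-\xi(Y)$ for all $Y\in D$. Then $\Lambda$ and $\Lambda_1$ are Poisson structures on $M$, and they are compatible (that is, $\Lambda+\Lambda_1$ is a Poisson structure too) if and only if $$\alpha_1\wedge\dots\wedge\alpha_r\wedge d\Omega_2=0\quad\text{on } M\times\mathbb K^r.$$ -/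

import Mathlib

open scoped ContDiff

noncomputable section

namespace VeroneseModel

/-! ### Linear algebra of forms at a point -/

section Forms

variable {𝕜 : Type*} [RCLike 𝕜]
variable {E : Type*} [NormedAddCommGroup E] [NormedSpace 𝕜 E]

/-- A covector regarded as an alternating form of degree `1`. -/
def oneForm (ξ : E →L[𝕜] 𝕜) : E [⋀^Fin 1]→L[𝕜] 𝕜 :=
  ContinuousAlternatingMap.ofSubsingleton 𝕜 E 𝕜 (0 : Fin 1) ξ

/-- The exterior product `ξ ∧ θ` of a covector and a `k`-form:
`(ξ ∧ θ)(v₀, …, v_k) = ∑ i, (-1)^i ξ(v_i) θ(v₀, …, v̂_i, …, v_k)`. -/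
def wedgeOne {k : ℕ} (ξ : E →L[𝕜] 𝕜) (θ : E [⋀^Fin k]→L[𝕜] 𝕜) :
    E [⋀^Fin (k + 1)]→L[𝕜] 𝕜 :=
  ContinuousAlternatingMap.alternatizeUncurryFin (ξ.smulRight θ)

/-- The exterior product `ξ₁ ∧ … ∧ ξ_r ∧ θ` of `r` covectors and a `k`-form. -/
def wedgeAll {k : ℕ} : (r : ℕ) → (Fin r → E →L[𝕜] 𝕜) → E [⋀^Fin k]→L[𝕜] 𝕜 →
    E [⋀^Fin (k + r)]→L[𝕜] 𝕜
  | 0, _, θ => θ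
  | r + 1, ξ, θ => wedgeOne (ξ 0) (wedgeAll r (fun i => ξ i.succ) θ)

/-- The map `X ↦ σ(X, ·)` of a `2`-form `σ`. -/
def flat (σ : E [⋀^Fin 2]→L[𝕜] 𝕜) : E →L[𝕜] (E →L[𝕜] 𝕜) :=
  ((ContinuousAlternatingMap.ofSubsingletonLIE (𝕜 := 𝕜) (E := E) (F := 𝕜)
      (0 : Fin 1)).symm.toContinuousLinearEquiv :
    (E [⋀^Fin 1]→L[𝕜] 𝕜) →L[𝕜] (E →L[𝕜] 𝕜)) ∘L σ.curryLeft

theorem flat_apply (σ : E [⋀^Fin 2]→L[𝕜] 𝕜) (X Y : E) : flat σ X Y = σ ![X, Y] := by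
  have h : (fun _ : Fin 1 => Y) = ![Y] := by
    funext i; fin_cases i; rfl
  change σ.curryLeft X (fun _ => Y) = _
  rw [ContinuousAlternatingMap.curryLeft_apply_apply, h]

/-- A `2`-form is nondegenerate when its only null vector is `0`. -/
def Nondeg (σ : E [⋀^Fin 2]→L[𝕜] 𝕜) : Prop :=
  ∀ X, (∀ Y, σ ![X, Y] = 0) → X = 0

/-- The endomorphism `H` with `σ₁(X, Y) = σ(H X, Y)`, for `σ` nondegenerate. -/
def connecting (σ σ₁ : E [⋀^Fin 2]→L[𝕜] 𝕜) : E →L[𝕜] E :=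
  (flat σ).inverse ∘L flat σ₁

/-- A bilinear form that vanishes on the diagonal, as an alternating form of degree `2`. -/
def ofBilin (B : E →L[𝕜] E →L[𝕜] 𝕜) (hB : ∀ X, B X X = 0) : E [⋀^Fin 2]→L[𝕜] 𝕜 :=
  { ContinuousLinearMap.uncurryLeft
      (((ContinuousMultilinearMap.ofSubsingletonₗᵢ (𝕜 := 𝕜) (G := E) (G' := 𝕜)
        (0 : Fin 1)).toContinuousLinearEquiv :
        (E →L[𝕜] 𝕜) →L[𝕜] ContinuousMultilinearMap 𝕜 (fun _ : Fin 1 => E) 𝕜) ∘L B) with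
    map_eq_zero_of_eq' := by
      intro v i j h hij
      have h01 : v 0 = v 1 := by
        fin_cases i <;> fin_cases j <;> simp_all
      change B (v 0) (v 1) = 0
      rw [← h01]; exact hB _ }

theorem ofBilin_apply (B : E →L[𝕜] E →L[𝕜] 𝕜) (hB : ∀ X, B X X = 0) (X Y : E) :
    ofBilin B hB ![X, Y] = B X Y := rfl

theorem form_swap (σ : E [⋀^Fin 2]→L[𝕜] 𝕜) (X Y : E) : flat σ X Y = - flat σ Y X := by
  have hd : ∀ Z, flat σ Z Z = 0 := fun Z => by
    rw [flat_apply]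
    exact σ.map_eq_zero_of_eq ![Z, Z] (i := 0) (j := 1) rfl (by decide)
  have h := hd (X + Y)
  simp only [map_add, add_apply, hd] at h
  linear_combination h

theorem connecting_sq_diag (σ σ₁ : E [⋀^Fin 2]→L[𝕜] 𝕜) (X : E) :
    (flat σ ∘L connecting σ σ₁ ∘L connecting σ σ₁) X X = 0 := by
  change flat σ (connecting σ σ₁ (connecting σ σ₁ X)) X = 0
  by_cases hi : (flat σ).IsInvertible
  · have key : ∀ Z, flat σ (connecting σ σ₁ Z) = flat σ₁ Z := fun Z => by
      obtain ⟨e, he⟩ := hi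
      simp [connecting, ← he]
    have h1 := form_swap σ (connecting σ σ₁ X) (connecting σ σ₁ X)
    rw [key, form_swap σ₁, ← key]
    rw [self_eq_neg] at h1
    rw [h1, neg_zero]
  · simp [connecting, ContinuousLinearMap.inverse_of_not_isInvertible hi]

/-- The `2`-form `σ(H² ·, ·)`, where `H` is the endomorphism with `σ₁ = σ(H ·, ·)`. -/
def secondForm (σ σ₁ : E [⋀^Fin 2]→L[𝕜] 𝕜) : E [⋀^Fin 2]→L[𝕜] 𝕜 :=
  ofBilin (flat σ ∘L connecting σ σ₁ ∘L connecting σ σ₁) (connecting_sq_diag σ σ₁)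

theorem secondForm_apply (σ σ₁ : E [⋀^Fin 2]→L[𝕜] 𝕜) (X Y : E) :
    secondForm σ σ₁ ![X, Y] = σ ![connecting σ σ₁ (connecting σ σ₁ X), Y] := by
  rw [secondForm, ofBilin_apply, ← flat_apply]; rfl

theorem flat_isInvertible [FiniteDimensional 𝕜 E] (σ : E [⋀^Fin 2]→L[𝕜] 𝕜) (hσ : Nondeg σ) :
    (flat σ).IsInvertible := by
  have hinj : Function.Injective (flat σ) := by
    rw [injective_iff_map_eq_zero]
    intro X hX
    refine hσ X fun Y => ?_
    rw [← flat_apply, hX]; rfl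
  have hfin : Module.finrank 𝕜 E = Module.finrank 𝕜 (E →L[𝕜] 𝕜) := by
    rw [← (LinearMap.toContinuousLinearMap (𝕜 := 𝕜) (E := E) (F' := 𝕜)).finrank_eq]
    exact Subspace.dual_finrank_eq.symm
  have hfd : FiniteDimensional 𝕜 (E →L[𝕜] 𝕜) :=
    (LinearMap.toContinuousLinearMap (𝕜 := 𝕜) (E := E) (F' := 𝕜)).finiteDimensional
  let e : E ≃ₗ[𝕜] (E →L[𝕜] 𝕜) :=
    LinearEquiv.ofInjectiveOfFinrankEq (flat σ : E →ₗ[𝕜] (E →L[𝕜] 𝕜)) hinj hfin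
  refine ⟨e.toContinuousLinearEquiv, ?_⟩
  ext X Y
  rfl

/-- `connecting` has its defining property. -/
theorem connecting_spec [FiniteDimensional 𝕜 E] (σ σ₁ : E [⋀^Fin 2]→L[𝕜] 𝕜) (hσ : Nondeg σ)
    (X Y : E) : σ ![connecting σ σ₁ X, Y] = σ₁ ![X, Y] := by
  obtain ⟨e, he⟩ := flat_isInvertible σ hσ
  rw [← flat_apply, ← flat_apply, connecting, ← he]
  simp

/-- The common kernel of a family of covectors. -/
def commonKer {r : ℕ} (η : Fin r → E →L[𝕜] 𝕜) : Submodule 𝕜 E :=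
  ⨅ k, LinearMap.ker (η k : E →ₗ[𝕜] 𝕜)

/-- The restriction of a `2`-form to the common kernel of `η₁, …, η_r`. -/
def restrictKer {r : ℕ} (η : Fin r → E →L[𝕜] 𝕜) (σ : E [⋀^Fin 2]→L[𝕜] 𝕜) :
    commonKer η [⋀^Fin 2]→L[𝕜] 𝕜 :=
  σ.compContinuousLinearMap (commonKer η).subtypeL

/-- The map `Λ♯ : E* → E` of the bivector given by covectors `η₁, …, η_r` and a `2`-form `σ`
that is nondegenerate on `D = ker η₁ ∩ … ∩ ker η_r`: the vector `Λ♯ ξ` is the element of `D`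
with `σ(Λ♯ ξ, Y) = -ξ(Y)` for all `Y ∈ D`. The sign is the one for which
`Λ♯ dx = ∂/∂y` when `σ = dx ∧ dy`. -/
def leafSharp {r : ℕ} (η : Fin r → E →L[𝕜] 𝕜) (σ : E [⋀^Fin 2]→L[𝕜] 𝕜) :
    (E →L[𝕜] 𝕜) →L[𝕜] E :=
  -((commonKer η).subtypeL ∘L (flat (restrictKer η σ)).inverse ∘L
      ContinuousLinearMap.precomp 𝕜 (commonKer η).subtypeL)

/-- `leafSharp` has its defining property. -/
theorem leafSharp_spec [FiniteDimensional 𝕜 E] {r : ℕ} (η : Fin r → E →L[𝕜] 𝕜)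
    (σ : E [⋀^Fin 2]→L[𝕜] 𝕜) (hσ : Nondeg (restrictKer η σ)) (ξ : E →L[𝕜] 𝕜) :
    leafSharp η σ ξ ∈ commonKer η ∧
      ∀ Y ∈ commonKer η, σ ![leafSharp η σ ξ, Y] = -ξ Y := by
  refine ⟨(commonKer η).neg_mem (Subtype.mem _), fun Y hY => ?_⟩
  obtain ⟨e, he⟩ := flat_isInvertible _ hσ
  rw [leafSharp, ← he]
  let ζ := ContinuousLinearMap.precomp 𝕜 (commonKer η).subtypeL ξ
  have h1 : flat (restrictKer η σ) (e.symm ζ) ⟨Y, hY⟩ = ξ Y := by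
    rw [← he]
    change e (e.symm ζ) ⟨Y, hY⟩ = ξ Y
    rw [e.apply_symm_apply]; rfl
  have h2 : flat σ (e.symm ζ : E) Y = ξ Y := by
    rw [← h1, flat_apply, flat_apply, restrictKer,
      ContinuousAlternatingMap.compContinuousLinearMap_apply]
    congr 1
    funext i; fin_cases i <;> rfl
  rw [← flat_apply, ContinuousLinearMap.inverse_equiv]
  change flat σ (-(e.symm ζ : E)) Y = -ξ Y
  rw [map_neg, neg_apply, h2]

/-! ### Poisson structures on open sets

A bivector `Λ` at a point is represented by the map `Λ♯ : E* → E`, `ξ ↦ Λ(ξ, ·)`, so that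
`Λ(ξ, ζ) = ζ(Λ♯ ξ)` for covectors `ξ`, `ζ`. -/

/-- The bracket `{f, g} = Λ(df, dg)`. -/
def bracket (Λ : E → (E →L[𝕜] 𝕜) →L[𝕜] E) (f g : E → 𝕜) : E → 𝕜 :=
  fun p => fderiv 𝕜 g p (Λ p (fderiv 𝕜 f p))

/-- `Λ` is a Poisson structure on the open set `U`: a smooth (holomorphic if `𝕜 = ℂ`) field of
bivectors whose bracket satisfies the Jacobi identity for all functions on open subsets of `U`. -/
structure IsPoissonOn (Λ : E → (E →L[𝕜] 𝕜) →L[𝕜] E) (U : Set E) : Prop where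
  smooth : ContDiffOn 𝕜 ∞ Λ U
  skew : ∀ p ∈ U, ∀ ξ ζ : E →L[𝕜] 𝕜, ζ (Λ p ξ) = -ξ (Λ p ζ)
  jacobi : ∀ V ⊆ U, IsOpen V → ∀ f g h : E → 𝕜,
    ContDiffOn 𝕜 ∞ f V → ContDiffOn 𝕜 ∞ g V → ContDiffOn 𝕜 ∞ h V → ∀ p ∈ V,
      bracket Λ f (bracket Λ g h) p + bracket Λ g (bracket Λ h f) p +
        bracket Λ h (bracket Λ f g) p = 0

end Forms

/-! ### The spaces of the local model

`q` stands for `n - r`. The index `j` of the coordinates `x_j` runs over `Fin q ⊕ Fin r`, where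
`Fin q` is the block `1, …, n - r` and `Fin r` is the block `n - r + 1, …, n`. The coordinates
`z_{2k-1}`, `z_{2k}` are indexed by `(k, 0)` and `(k, 1)`. -/

section Model

variable (𝕜 : Type*) [RCLike 𝕜] (q r m : ℕ)

/-- Coordinates `x` of `N`. -/
abbrev NSpace := Fin q ⊕ Fin r → 𝕜

/-- Coordinates `(x, z)` of `P`. -/
abbrev PSpace := NSpace 𝕜 q r × (Fin m × Fin 2 → 𝕜)

/-- Coordinates `(x, (y₁, …, y_{n-r}), z)` of `M`. -/
abbrev MSpace := NSpace 𝕜 q r × (Fin q → 𝕜) × (Fin m × Fin 2 → 𝕜)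

/-- Coordinates of `M × 𝕜^r`; the second factor has coordinates `y_{n-r+1}, …, y_n`. -/
abbrev TSpace := MSpace 𝕜 q r m × (Fin r → 𝕜)

variable {𝕜 q r m}

/-- The scalars `a₁, …, a_{n-r}, a, …, a`. -/
def eig (a : Fin q → 𝕜) (a₀ : 𝕜) : Fin q ⊕ Fin r → 𝕜 := Sum.elim a (fun _ => a₀)

/-- The constant tensor field `J` on `N`, with `dx_j ∘ J = a_j dx_j` for `j ≤ n - r` and
`dx_j ∘ J = a dx_j` for `j > n - r`. -/
def tensorJ (a : Fin q → 𝕜) (a₀ : 𝕜) : NSpace 𝕜 q r →L[𝕜] NSpace 𝕜 q r :=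
  ContinuousLinearMap.pi fun j => eig (r := r) a a₀ j • ContinuousLinearMap.proj j

/-- The closed `1`-forms `α₁, …, α_r` and `J` describe a Veronese web of codimension `r` on the
open set `N`, namely `w(t) = (J + tI) (ker α₁ ∩ … ∩ ker α_r)`, `w(∞) = ker α₁ ∩ … ∩ ker α_r`. -/
structure IsVeroneseWeb (a : Fin q → 𝕜) (a₀ : 𝕜)
    (α : Fin r → NSpace 𝕜 q r → (NSpace 𝕜 q r →L[𝕜] 𝕜)) (N : Set (NSpace 𝕜 q r)) :
    Prop where
  ne_zero : (∀ j, a j ≠ 0) ∧ a₀ ≠ 0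
  distinct : Function.Injective a ∧ ∀ j, a j ≠ a₀
  smooth : ∀ k, ContDiffOn 𝕜 ∞ (α k) N
  closed : ∀ k, ∀ x ∈ N, extDeriv (fun x => oneForm (α k x)) x = 0
  indep : ∀ x ∈ N, LinearIndependent 𝕜 (fun k => α k x)
  /-- `α₁ ∧ … ∧ α_r ∧ d(α_k ∘ J) = 0`. -/
  twisted_closed : ∀ k, ∀ x ∈ N, wedgeAll r (fun i => α i x)
    (extDeriv (fun x => oneForm (α k x ∘L tensorJ a a₀)) x) = 0
  /-- `ker α₁ ∩ … ∩ ker α_r` contains no nonzero `J`-invariant subspace. -/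
  no_invariant : ∀ x ∈ N, ∀ W : Submodule 𝕜 (NSpace 𝕜 q r),
    W ≤ commonKer (fun k => α k x) → (∀ w ∈ W, tensorJ a a₀ w ∈ W) → W = ⊥

/-- The projection `M → N`, `(x, y, z) ↦ x`. -/
def projN : MSpace 𝕜 q r m →L[𝕜] NSpace 𝕜 q r := ContinuousLinearMap.fst 𝕜 _ _

/-- The projection `M → P`, `(x, y, z) ↦ (x, z)`. -/
def projP : MSpace 𝕜 q r m →L[𝕜] PSpace 𝕜 q r m :=
  (ContinuousLinearMap.fst 𝕜 _ _).prod
    (ContinuousLinearMap.snd 𝕜 _ _ ∘L ContinuousLinearMap.snd 𝕜 _ _)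

/-- The projection `M × 𝕜^r → M`. -/
def projM : TSpace 𝕜 q r m →L[𝕜] MSpace 𝕜 q r m := ContinuousLinearMap.fst 𝕜 _ _

/-- The inclusion of `M` as `M × {0}` in `M × 𝕜^r`. -/
def inclM : MSpace 𝕜 q r m →L[𝕜] TSpace 𝕜 q r m := ContinuousLinearMap.inl 𝕜 _ _

/-- The coordinate form `dx_j` on `M × 𝕜^r`. -/
def dx (j : Fin q ⊕ Fin r) : TSpace 𝕜 q r m →L[𝕜] 𝕜 :=
  ContinuousLinearMap.proj j ∘L projN ∘L projM

/-- The coordinate form `dy_j` on `M × 𝕜^r`. -/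
def dy : Fin q ⊕ Fin r → (TSpace 𝕜 q r m →L[𝕜] 𝕜)
  | Sum.inl j => ContinuousLinearMap.proj j ∘L ContinuousLinearMap.fst 𝕜 _ _ ∘L
      ContinuousLinearMap.snd 𝕜 _ _ ∘L projM
  | Sum.inr j => ContinuousLinearMap.proj j ∘L ContinuousLinearMap.snd 𝕜 _ _

/-- The coordinate form `dz_{2k-1}` (if `e = 0`) or `dz_{2k}` (if `e = 1`) on `M × 𝕜^r`. -/
def dz (k : Fin m) (e : Fin 2) : TSpace 𝕜 q r m →L[𝕜] 𝕜 :=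
  ContinuousLinearMap.proj (k, e) ∘L ContinuousLinearMap.snd 𝕜 _ _ ∘L
    ContinuousLinearMap.snd 𝕜 _ _ ∘L projM

/-- `Ω = ∑ dx_j ∧ dy_j + ∑ dz_{2k-1} ∧ dz_{2k}` on `M × 𝕜^r`. -/
def formΩ : TSpace 𝕜 q r m → TSpace 𝕜 q r m [⋀^Fin 2]→L[𝕜] 𝕜 := fun _ =>
  ∑ j, wedgeOne (dx j) (oneForm (dy j)) + ∑ k, wedgeOne (dz k 0) (oneForm (dz k 1))

/-- `Ω₁ = ∑_{j ≤ n-r} a_j dx_j ∧ dy_j + ∑_{j > n-r} a dx_j ∧ dy_j + Ω'₁` on `M × 𝕜^r`, where `Ω'₁`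
is a `2`-form in `dx`, `dz` whose coefficients are functions of `(x, z)`, that is, the pull-back
of a `2`-form `β` on `P`. -/
def formΩ₁ (a : Fin q → 𝕜) (a₀ : 𝕜)
    (β : PSpace 𝕜 q r m → PSpace 𝕜 q r m [⋀^Fin 2]→L[𝕜] 𝕜) :
    TSpace 𝕜 q r m → TSpace 𝕜 q r m [⋀^Fin 2]→L[𝕜] 𝕜 := fun p =>
  ∑ j, eig a a₀ j • wedgeOne (dx j) (oneForm (dy j)) +
    (β (projP (projM p))).compContinuousLinearMap (projP ∘L projM)

/-- `Ω₂ = Ω(H² ·, ·)`, where `Ω₁ = Ω(H ·, ·)`. -/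
def formΩ₂ (a : Fin q → 𝕜) (a₀ : 𝕜)
    (β : PSpace 𝕜 q r m → PSpace 𝕜 q r m [⋀^Fin 2]→L[𝕜] 𝕜) :
    TSpace 𝕜 q r m → TSpace 𝕜 q r m [⋀^Fin 2]→L[𝕜] 𝕜 := fun p =>
  secondForm (formΩ p) (formΩ₁ a a₀ β p)

/-- The bivector `Λ` on `M` given by `α₁ ∘ J⁻¹, …, α_r ∘ J⁻¹` (pulled back from `N`) and the
restriction of `Ω` to `M = M × {0}`. -/
def bivectorΛ (a : Fin q → 𝕜) (a₀ : 𝕜) (α : Fin r → NSpace 𝕜 q r → (NSpace 𝕜 q r →L[𝕜] 𝕜))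
    (p : MSpace 𝕜 q r m) :
    (MSpace 𝕜 q r m →L[𝕜] 𝕜) →L[𝕜] MSpace 𝕜 q r m :=
  leafSharp (fun k => α k (projN p) ∘L (tensorJ a a₀).inverse ∘L projN)
    ((formΩ (inclM p)).compContinuousLinearMap inclM)

/-- The bivector `Λ₁` on `M` given by `α₁, …, α_r` (pulled back from `N`) and the restriction of
`Ω₁` to `M = M × {0}`. -/
def bivectorΛ₁ (a : Fin q → 𝕜) (a₀ : 𝕜)
    (α : Fin r → NSpace 𝕜 q r → (NSpace 𝕜 q r →L[𝕜] 𝕜))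
    (β : PSpace 𝕜 q r m → PSpace 𝕜 q r m [⋀^Fin 2]→L[𝕜] 𝕜) (p : MSpace 𝕜 q r m) :
    (MSpace 𝕜 q r m →L[𝕜] 𝕜) →L[𝕜] MSpace 𝕜 q r m :=
  leafSharp (fun k => α k (projN p) ∘L projN)
    ((formΩ₁ a a₀ β (inclM p)).compContinuousLinearMap inclM)

end Model

end VeroneseModel

end

/-!
Both `Ω` and `Ω₁` are symplectic forms `∑ b_j dx_j ∧ dy_j + γ` on `M × 𝕜^r` (`modelForm`), and all
three bivector fields on `M` are reductions of bivector fields on `M × 𝕜^r`. Let `κ₁, …, κ_r` be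
the basis of the span of the `α_k ∘ J⁻¹` with `κ_l = dx_{n-r+l}` on the last `r` coordinate
directions (`coframe`); it exists because `⋂ ker α_k` contains no nonzero `J`-invariant subspace,
so that the `α_k` are independent on the eigenspace of the eigenvalue `a`. With
`S(x)_{jl} = κ_l(∂/∂x_j)`, the map `π(x, y, z, y') = (x, y - S(x) y', z)` (`reduction`) restricts
to the identity of `M = M × {0}`, and the kernel of its derivative is both the `Ω`-orthogonal of
`⋂ ker (α_k ∘ J⁻¹)` and the `Ω₁`-orthogonal of `⋂ ker α_k`. It carries `Ω⁻¹` to `Λ` and `Ω₁⁻¹` to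
`Λ₁` (`leafSharp_eq_reduction`). The derivative of `S` enters here; its contribution vanishes
because the `κ_l` are closed on `⋂ ker (α_k ∘ J⁻¹)` and the `κ_l ∘ J` are closed on `⋂ ker α_k`,
which is what the closedness of `α_k` and the condition on `d(α_k ∘ J)` amount to.

The Jacobiator of a bivector field is compatible with such a map (`jacobiator_of_related`), and on
`M × 𝕜^r` it is an exterior derivative: that of `Ω₁⁻¹` is `-dΩ₁` (`jacobiator_sharp`), that of the
constant field `Ω⁻¹` is zero, and that of `Ω⁻¹ + Ω₁⁻¹` is `dΩ₂` evaluated on the vectors `Ω₁⁻¹ ξ`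
(`jacobiator_sharp_add`). So `Λ` and `Λ₁` are Poisson, and `Λ + Λ₁` is Poisson exactly when `dΩ₂`
vanishes on the vectors `Ω₁⁻¹ ξ` with `ξ` pulled back by `π`. These fill `⋂ ker α_k`
(`IsAdapted.apply_sharp_eq_zero`, `IsAdapted.exists_sharp_eq`), and a form vanishes there exactly
when its exterior product with `α₁ ∧ … ∧ α_r` is zero (`wedgeAll_eq_zero_iff`). Working over
`M × {0}` is enough because nothing depends on `y'`.
-/

noncomputable section

open Filter Topology

namespace VeroneseModel

/-! ### The Jacobiator of a bivector field -/

section Jacobiator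

variable {𝕜 : Type*} [RCLike 𝕜]
variable {E : Type*} [NormedAddCommGroup E] [NormedSpace 𝕜 E]
variable {F : Type*} [NormedAddCommGroup F] [NormedSpace 𝕜 F]

/-- The Jacobiator (half the Schouten bracket `[Λ, Λ]`, up to sign) of a field `Λ` of maps
`E* → E` at the point `p`, evaluated on three covectors. -/
def jacobiator (Λ : E → (E →L[𝕜] 𝕜) →L[𝕜] E) (p : E) (ξ ζ θ : E →L[𝕜] 𝕜) : 𝕜 :=
  θ (fderiv 𝕜 Λ p (Λ p ξ) ζ) + ξ (fderiv 𝕜 Λ p (Λ p ζ) θ) + ζ (fderiv 𝕜 Λ p (Λ p θ) ξ)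

theorem differentiableAt_bracket_and_fderiv {Λ : E → (E →L[𝕜] 𝕜) →L[𝕜] E} {p : E} {g h : E → 𝕜}
    (hΛ : DifferentiableAt 𝕜 Λ p) (hg : ContDiffAt 𝕜 2 g p) (hh : ContDiffAt 𝕜 2 h p) :
    DifferentiableAt 𝕜 (bracket Λ g h) p ∧ ∀ v, fderiv 𝕜 (bracket Λ g h) p v =
      fderiv 𝕜 (fderiv 𝕜 h) p v (Λ p (fderiv 𝕜 g p)) +
        fderiv 𝕜 h p (fderiv 𝕜 Λ p v (fderiv 𝕜 g p)) +
        fderiv 𝕜 h p (Λ p (fderiv 𝕜 (fderiv 𝕜 g) p v)) := by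
  have hg' : DifferentiableAt 𝕜 (fderiv 𝕜 g) p :=
    (hg.fderiv_right (m := 1) (by norm_num)).differentiableAt (by norm_num)
  have hh' : DifferentiableAt 𝕜 (fderiv 𝕜 h) p :=
    (hh.fderiv_right (m := 1) (by norm_num)).differentiableAt (by norm_num)
  have key := hh'.hasFDerivAt.clm_apply (hΛ.hasFDerivAt.clm_apply hg'.hasFDerivAt)
  have key' : HasFDerivAt (bracket Λ g h) _ p := key
  refine ⟨key'.differentiableAt, fun v => ?_⟩
  rw [key'.fderiv]
  simp
  ring

/-- The second derivatives of `f`, `g`, `h` cancel in the cyclic sum of iterated brackets. -/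
theorem cyclic_bracket_eq_jacobiator {Λ : E → (E →L[𝕜] 𝕜) →L[𝕜] E} {p : E} {f g h : E → 𝕜}
    (hΛ : DifferentiableAt 𝕜 Λ p) (hskew : ∀ ξ ζ : E →L[𝕜] 𝕜, ζ (Λ p ξ) = -ξ (Λ p ζ))
    (hf : ContDiffAt 𝕜 2 f p) (hg : ContDiffAt 𝕜 2 g p) (hh : ContDiffAt 𝕜 2 h p) :
    bracket Λ f (bracket Λ g h) p + bracket Λ g (bracket Λ h f) p +
        bracket Λ h (bracket Λ f g) p =
      jacobiator Λ p (fderiv 𝕜 f p) (fderiv 𝕜 g p) (fderiv 𝕜 h p) := by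
  have symm : ∀ {u : E → 𝕜}, ContDiffAt 𝕜 2 u p → ∀ v w,
      fderiv 𝕜 (fderiv 𝕜 u) p v w = fderiv 𝕜 (fderiv 𝕜 u) p w v := fun hu v w =>
    (hu.isSymmSndFDerivAt (by simp)).eq v w
  simp only [bracket] at *
  rw [(differentiableAt_bracket_and_fderiv hΛ hg hh).2,
    (differentiableAt_bracket_and_fderiv hΛ hh hf).2,
    (differentiableAt_bracket_and_fderiv hΛ hf hg).2,
    hskew (fderiv 𝕜 (fderiv 𝕜 g) p _), hskew (fderiv 𝕜 (fderiv 𝕜 h) p _),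
    hskew (fderiv 𝕜 (fderiv 𝕜 f) p _),
    symm hf (Λ p (fderiv 𝕜 g p)), symm hg (Λ p (fderiv 𝕜 h p)), symm hh (Λ p (fderiv 𝕜 f p))]
  simp only [jacobiator]
  ring

theorem isPoissonOn_iff {Λ : E → (E →L[𝕜] 𝕜) →L[𝕜] E} {U : Set E} (hU : IsOpen U)
    (smooth : ContDiffOn 𝕜 ∞ Λ U)
    (skew : ∀ p ∈ U, ∀ ξ ζ : E →L[𝕜] 𝕜, ζ (Λ p ξ) = -ξ (Λ p ζ)) :
    IsPoissonOn Λ U ↔ ∀ p ∈ U, ∀ ξ ζ θ, jacobiator Λ p ξ ζ θ = 0 := by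
  have hd : ∀ p ∈ U, DifferentiableAt 𝕜 Λ p := fun p hp =>
    (smooth.contDiffAt (hU.mem_nhds hp)).differentiableAt (by simp)
  constructor
  · intro H p hp ξ ζ θ
    have h := H.jacobi U subset_rfl hU ξ ζ θ ξ.contDiff.contDiffOn ζ.contDiff.contDiffOn
      θ.contDiff.contDiffOn p hp
    rw [cyclic_bracket_eq_jacobiator (hd p hp) (skew p hp) ξ.contDiff.contDiffAt
      ζ.contDiff.contDiffAt θ.contDiff.contDiffAt] at h
    simpa using h
  · intro H
    refine ⟨smooth, skew, fun V hVU hV f g h hf hg hh p hp => ?_⟩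
    have two : ∀ {u : E → 𝕜}, ContDiffOn 𝕜 ∞ u V → ContDiffAt 𝕜 2 u p := fun hu =>
      (hu.contDiffAt (hV.mem_nhds hp)).of_le (WithTop.coe_le_coe.2 le_top)
    rw [cyclic_bracket_eq_jacobiator (hd p (hVU hp)) (skew p (hVU hp)) (two hf) (two hg) (two hh)]
    exact H p (hVU hp) _ _ _

/-- If `π` carries the bivector field `R` to `Λ`, then it carries the Jacobiator of `R` to the
Jacobiator of `Λ`: the bracket of pulled back functions is the pull-back of their bracket. -/
theorem jacobiator_of_related {R : E → (E →L[𝕜] 𝕜) →L[𝕜] E} {Λ : F → (F →L[𝕜] 𝕜) →L[𝕜] F}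
    {π : E → F} {p : E} (hπ : ContDiffAt 𝕜 ∞ π p) (hR : DifferentiableAt 𝕜 R p)
    (hΛ : DifferentiableAt 𝕜 Λ (π p)) (hskew : ∀ ξ ζ : E →L[𝕜] 𝕜, ζ (R p ξ) = -ξ (R p ζ))
    (hrel : ∀ᶠ p' in 𝓝 p, ∀ ξ : F →L[𝕜] 𝕜,
      Λ (π p') ξ = fderiv 𝕜 π p' (R p' (ξ ∘L fderiv 𝕜 π p'))) (ξ ζ θ : F →L[𝕜] 𝕜) :
    jacobiator Λ (π p) ξ ζ θ =
      jacobiator R p (ξ ∘L fderiv 𝕜 π p) (ζ ∘L fderiv 𝕜 π p) (θ ∘L fderiv 𝕜 π p) := by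
  have hπd : DifferentiableAt 𝕜 π p := hπ.differentiableAt (by simp)
  have hπe : ∀ᶠ p' in 𝓝 p, DifferentiableAt 𝕜 π p' :=
    ((hπ.of_le (m := 1) (by exact_mod_cast le_top)).eventually (by simp)).mono
      fun _ h => h.differentiableAt (by simp)
  have hcomp : ∀ (ξ : F →L[𝕜] 𝕜) {p' : E}, DifferentiableAt 𝕜 π p' →
      fderiv 𝕜 (fun q => ξ (π q)) p' = ξ ∘L fderiv 𝕜 π p' := fun ξ p' h =>
    (ξ.hasFDerivAt.comp p' h.hasFDerivAt).fderiv
  have hC : ∀ ξ : F →L[𝕜] 𝕜, ContDiffAt 𝕜 2 (fun q => ξ (π q)) p := fun ξ =>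
    ξ.contDiff.contDiffAt.comp p (hπ.of_le (WithTop.coe_le_coe.2 le_top))
  have hb : ∀ ζ θ : F →L[𝕜] 𝕜, (fun q => bracket Λ ζ θ (π q)) =ᶠ[𝓝 p]
      bracket R (fun q => ζ (π q)) (fun q => θ (π q)) := fun ζ θ => by
    filter_upwards [hrel, hπe] with p' h1 h2
    simp only [bracket, hcomp _ h2, ContinuousLinearMap.fderiv, h1]
    rfl
  have hrp := hrel.self_of_nhds
  have hskewΛ : ∀ ξ ζ : F →L[𝕜] 𝕜, ζ (Λ (π p) ξ) = -ξ (Λ (π p) ζ) := fun ξ ζ => by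
    rw [hrp, hrp]
    exact hskew (ξ ∘L fderiv 𝕜 π p) (ζ ∘L fderiv 𝕜 π p)
  have hbb : ∀ ξ ζ θ : F →L[𝕜] 𝕜, bracket Λ ξ (bracket Λ ζ θ) (π p) =
      bracket R (fun q => ξ (π q)) (bracket R (fun q => ζ (π q)) (fun q => θ (π q))) p :=
    fun ξ ζ θ => by
    have hd := (differentiableAt_bracket_and_fderiv hΛ (g := ζ) (h := θ) ζ.contDiff.contDiffAt
      θ.contDiff.contDiffAt).1
    rw [bracket, bracket, ← (hb ζ θ).fderiv_eq, hcomp ξ hπd, ContinuousLinearMap.fderiv, hrp]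
    have hc : fderiv 𝕜 (fun q => bracket Λ ζ θ (π q)) p = _ :=
      (hd.hasFDerivAt.comp p hπd.hasFDerivAt).fderiv
    rw [hc]
    rfl
  have h1 := cyclic_bracket_eq_jacobiator hΛ hskewΛ (f := ξ) (g := ζ) (h := θ)
    ξ.contDiff.contDiffAt ζ.contDiff.contDiffAt θ.contDiff.contDiffAt
  have h2 := cyclic_bracket_eq_jacobiator hR hskew (hC ξ) (hC ζ) (hC θ)
  rw [hbb, hbb, hbb] at h1
  rw [h1] at h2
  simpa only [hcomp _ hπd, ContinuousLinearMap.fderiv] using h2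

end Jacobiator

/-! ### Symplectic forms and their inverse bivectors -/

section Symplectic

variable {𝕜 : Type*} [RCLike 𝕜]
variable {E : Type*} [NormedAddCommGroup E] [NormedSpace 𝕜 E]

variable (𝕜 E) in
/-- `flat` as a continuous linear map. -/
def flatCLM : (E [⋀^Fin 2]→L[𝕜] 𝕜) →L[𝕜] (E →L[𝕜] (E →L[𝕜] 𝕜)) :=
  ContinuousLinearMap.compL 𝕜 E (E [⋀^Fin 1]→L[𝕜] 𝕜) (E →L[𝕜] 𝕜)
    ((ContinuousAlternatingMap.ofSubsingletonLIE (𝕜 := 𝕜) (E := E) (F := 𝕜)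
      (0 : Fin 1)).symm.toContinuousLinearEquiv :
    (E [⋀^Fin 1]→L[𝕜] 𝕜) →L[𝕜] (E →L[𝕜] 𝕜)) ∘L
  (ContinuousAlternatingMap.curryLeftLI (𝕜 := 𝕜) (E := E) (F := 𝕜)
    (n := 1)).toContinuousLinearMap

theorem flatCLM_apply (σ : E [⋀^Fin 2]→L[𝕜] 𝕜) : flatCLM 𝕜 E σ = flat σ := rfl

theorem hasFDerivAt_flat {F : Type*} [NormedAddCommGroup F] [NormedSpace 𝕜 F]
    {τ : F → E [⋀^Fin 2]→L[𝕜] 𝕜} {τ' : F →L[𝕜] E [⋀^Fin 2]→L[𝕜] 𝕜} {p : F}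
    (h : HasFDerivAt τ τ' p) : HasFDerivAt (fun x => flat (τ x)) (flatCLM 𝕜 E ∘L τ') p :=
  have h0 : HasFDerivAt (fun σ : E [⋀^Fin 2]→L[𝕜] 𝕜 => flat σ) (flatCLM 𝕜 E) (τ p) :=
    ContinuousLinearMap.hasFDerivAt (𝕜 := 𝕜) (E := E [⋀^Fin 2]→L[𝕜] 𝕜)
      (F := E →L[𝕜] E →L[𝕜] 𝕜) (x := τ p) (flatCLM 𝕜 E)
  HasFDerivAt.comp (G := E →L[𝕜] E →L[𝕜] 𝕜) (g := fun σ => flat σ) p h0 h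

theorem contDiffAt_flat {F : Type*} [NormedAddCommGroup F] [NormedSpace 𝕜 F] {n : ℕ∞ω}
    {τ : F → E [⋀^Fin 2]→L[𝕜] 𝕜} {p : F} (h : ContDiffAt 𝕜 n τ p) :
    ContDiffAt 𝕜 n (fun x => flat (τ x)) p :=
  have h0 : ContDiff 𝕜 n (fun σ : E [⋀^Fin 2]→L[𝕜] 𝕜 => flat σ) :=
    ContinuousLinearMap.contDiff (𝕜 := 𝕜) (E := E [⋀^Fin 2]→L[𝕜] 𝕜)
      (F := E →L[𝕜] E →L[𝕜] 𝕜) (n := n) (flatCLM 𝕜 E)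
  ContDiffAt.comp (G := E →L[𝕜] E →L[𝕜] 𝕜) (g := fun σ => flat σ) p h0.contDiffAt h

theorem flat_add_apply (σ ρ : E [⋀^Fin 2]→L[𝕜] 𝕜) (X Y : E) :
    flat (σ + ρ) X Y = flat σ X Y + flat ρ X Y := by
  simp only [flat_apply, ContinuousAlternatingMap.add_apply]

theorem flat_smul_apply (c : 𝕜) (σ : E [⋀^Fin 2]→L[𝕜] 𝕜) (X Y : E) :
    flat (c • σ) X Y = c * flat σ X Y := by
  simp only [flat_apply, ContinuousAlternatingMap.smul_apply, smul_eq_mul]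

theorem flat_sum_apply {ι : Type*} (s : Finset ι) (σ : ι → E [⋀^Fin 2]→L[𝕜] 𝕜) (X Y : E) :
    flat (∑ i ∈ s, σ i) X Y = ∑ i ∈ s, flat (σ i) X Y := by
  simp only [flat_apply, ContinuousAlternatingMap.sum_apply]

theorem flat_wedgeOne (ξ ζ : E →L[𝕜] 𝕜) (X Y : E) :
    flat (wedgeOne ξ (oneForm ζ)) X Y = ξ X * ζ Y - ζ X * ξ Y := by
  rw [flat_apply, wedgeOne, ContinuousAlternatingMap.alternatizeUncurryFin_apply]
  simp [Fin.sum_univ_two, oneForm, Fin.removeNth]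
  ring

theorem extDeriv_one_apply (η : E → E →L[𝕜] 𝕜) {p : E} (hη : DifferentiableAt 𝕜 η p) (X Y : E) :
    extDeriv (fun x => oneForm (η x)) p ![X, Y] = fderiv 𝕜 η p X Y - fderiv 𝕜 η p Y X := by
  have h : HasFDerivAt (fun x => oneForm (η x)) _ p :=
    ((ContinuousAlternatingMap.ofSubsingletonLIE (𝕜 := 𝕜) (E := E) (F := 𝕜)
      (0 : Fin 1)).toContinuousLinearEquiv :
      (E →L[𝕜] 𝕜) →L[𝕜] (E [⋀^Fin 1]→L[𝕜] 𝕜)).hasFDerivAt.comp p hη.hasFDerivAt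
  rw [extDeriv, h.fderiv, ContinuousAlternatingMap.alternatizeUncurryFin_apply]
  simp [Fin.sum_univ_two, Fin.removeNth, sub_eq_add_neg]

theorem extDeriv_two_apply (τ : E → E [⋀^Fin 2]→L[𝕜] 𝕜) (p X Y Z : E) :
    extDeriv τ p ![X, Y, Z] = flat (fderiv 𝕜 τ p X) Y Z + flat (fderiv 𝕜 τ p Y) Z X +
      flat (fderiv 𝕜 τ p Z) X Y := by
  rw [form_swap (fderiv 𝕜 τ p Y), extDeriv,
    ContinuousAlternatingMap.alternatizeUncurryFin_apply]
  have h0 : Fin.removeNth 0 ![X, Y, Z] = ![Y, Z] := by ext i; fin_cases i <;> rfl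
  have h1 : Fin.removeNth 1 ![X, Y, Z] = ![X, Z] := by ext i; fin_cases i <;> rfl
  have h2 : Fin.removeNth 2 ![X, Y, Z] = ![X, Y] := by ext i; fin_cases i <;> rfl
  simp [Fin.sum_univ_three, h0, h1, h2, flat_apply]

/-- The bivector `E* → E` inverse to a nondegenerate `2`-form `σ`, with the sign convention
`σ(sharp σ ξ, ·) = -ξ` of `leafSharp`. -/
def sharp (σ : E [⋀^Fin 2]→L[𝕜] 𝕜) : (E →L[𝕜] 𝕜) →L[𝕜] E := -(flat σ).inverse

variable (𝕜 E) in
/-- Half the alternation of a bilinear form. It is the identity on alternating bilinear forms, so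
it exhibits `secondForm`, which is built with a proof of alternation, as a smooth function. -/
def halfAlternatize : (E →L[𝕜] E →L[𝕜] 𝕜) →L[𝕜] (E [⋀^Fin 2]→L[𝕜] 𝕜) :=
  (2⁻¹ : 𝕜) • (ContinuousAlternatingMap.alternatizeUncurryFinCLM 𝕜 E 𝕜 ∘L
    ContinuousLinearMap.compL 𝕜 E (E →L[𝕜] 𝕜) (E [⋀^Fin 1]→L[𝕜] 𝕜)
    ((ContinuousAlternatingMap.ofSubsingletonLIE (𝕜 := 𝕜) (E := E) (F := 𝕜)
      (0 : Fin 1)).toContinuousLinearEquiv :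
    (E →L[𝕜] 𝕜) →L[𝕜] (E [⋀^Fin 1]→L[𝕜] 𝕜)))

theorem ext_flat {σ ρ : E [⋀^Fin 2]→L[𝕜] 𝕜} (h : ∀ X Y, flat σ X Y = flat ρ X Y) : σ = ρ := by
  ext v
  have hv : v = ![v 0, v 1] := by ext i; fin_cases i <;> rfl
  rw [hv, ← flat_apply, ← flat_apply, h]

theorem halfAlternatize_apply (B : E →L[𝕜] E →L[𝕜] 𝕜) (X Y : E) :
    flat (halfAlternatize 𝕜 E B) X Y = 2⁻¹ * (B X Y - B Y X) := by
  rw [flat_apply]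
  simp [halfAlternatize, ContinuousAlternatingMap.alternatizeUncurryFin_apply,
    Fin.sum_univ_two, Fin.removeNth]
  ring

theorem flat_secondForm (σ σ₁ : E [⋀^Fin 2]→L[𝕜] 𝕜) :
    flat (secondForm σ σ₁) = flat σ ∘L connecting σ σ₁ ∘L connecting σ σ₁ := by
  ext X Y
  rw [flat_apply, secondForm, ofBilin_apply]

theorem secondForm_eq_halfAlternatize (σ σ₁ : E [⋀^Fin 2]→L[𝕜] 𝕜) : secondForm σ σ₁ =
    halfAlternatize 𝕜 E (flat σ ∘L connecting σ σ₁ ∘L connecting σ σ₁) := by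
  refine ext_flat fun X Y => ?_
  rw [halfAlternatize_apply, ← flat_secondForm, form_swap _ Y X]
  ring

variable [FiniteDimensional 𝕜 E]

theorem flat_sharp {σ : E [⋀^Fin 2]→L[𝕜] 𝕜} (hσ : Nondeg σ) (ξ : E →L[𝕜] 𝕜) :
    flat σ (sharp σ ξ) = -ξ := by
  obtain ⟨e, he⟩ := flat_isInvertible σ hσ
  simp [sharp, ← he]

theorem sharp_flat {σ : E [⋀^Fin 2]→L[𝕜] 𝕜} (hσ : Nondeg σ) (X : E) :
    sharp σ (flat σ X) = -X := by
  obtain ⟨e, he⟩ := flat_isInvertible σ hσ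
  simp [sharp, ← he]

theorem apply_eq_flat_sharp {σ : E [⋀^Fin 2]→L[𝕜] 𝕜} (hσ : Nondeg σ) (ξ : E →L[𝕜] 𝕜) (X : E) :
    ξ X = flat σ X (sharp σ ξ) := by
  rw [form_swap, flat_sharp hσ]
  simp

theorem sharp_skew {σ : E [⋀^Fin 2]→L[𝕜] 𝕜} (hσ : Nondeg σ) (ξ ζ : E →L[𝕜] 𝕜) :
    ζ (sharp σ ξ) = -ξ (sharp σ ζ) := by
  rw [apply_eq_flat_sharp hσ, apply_eq_flat_sharp hσ ξ, form_swap]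

theorem connecting_sharp {σ σ₁ : E [⋀^Fin 2]→L[𝕜] 𝕜} (hσ₁ : Nondeg σ₁) (ξ : E →L[𝕜] 𝕜) :
    connecting σ σ₁ (sharp σ₁ ξ) = sharp σ ξ := by
  change (flat σ).inverse (flat σ₁ (sharp σ₁ ξ)) = _
  rw [flat_sharp hσ₁]
  simp [sharp]

theorem contDiffAt_sharp {n : ℕ∞ω} {τ : E → E [⋀^Fin 2]→L[𝕜] 𝕜} {p : E}
    (hτ : ContDiffAt 𝕜 n τ p) (hnd : Nondeg (τ p)) :
    ContDiffAt 𝕜 n (fun x => sharp (τ x)) p := by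
  have := FiniteDimensional.complete 𝕜 E
  have h : ContDiffAt 𝕜 n (fun x => (flat (τ x)).inverse) p :=
    ContDiffAt.comp p (g := ContinuousLinearMap.inverse)
      (flat_isInvertible _ hnd).contDiffAt_map_inverse (contDiffAt_flat hτ)
  exact h.neg

/-- The derivative of the inverse of `τ` is `sharp τ ∘ (Dτ)♭ ∘ sharp τ`. -/
theorem apply_fderiv_sharp {τ : E → E [⋀^Fin 2]→L[𝕜] 𝕜} {p : E}
    (hτ : ContDiffAt 𝕜 1 τ p) (hnd : ∀ᶠ x in 𝓝 p, Nondeg (τ x)) (v : E) (ξ θ : E →L[𝕜] 𝕜) :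
    θ (fderiv 𝕜 (fun x => sharp (τ x)) p v ξ) =
      -flat (fderiv 𝕜 τ p v) (sharp (τ p) ξ) (sharp (τ p) θ) := by
  have hp := hnd.self_of_nhds
  have hs := ((contDiffAt_sharp hτ hp).differentiableAt (by simp)).hasFDerivAt
  have hf : HasFDerivAt (fun x => flat (τ x)) _ p :=
    hasFDerivAt_flat (hτ.differentiableAt (by simp)).hasFDerivAt
  have h := (hf.clm_apply (hs.clm_apply (hasFDerivAt_const ξ p))).unique
    ((hasFDerivAt_const (-ξ) p).congr_of_eventuallyEq
      (hnd.mono fun x hx => flat_sharp hx ξ))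
  have h2 := congrArg (fun L => L v (sharp (τ p) θ)) h
  simp [flatCLM_apply] at h2
  rw [apply_eq_flat_sharp hp]
  linear_combination h2

theorem jacobiator_sharp {τ : E → E [⋀^Fin 2]→L[𝕜] 𝕜} {p : E}
    (hτ : ContDiffAt 𝕜 1 τ p) (hnd : ∀ᶠ x in 𝓝 p, Nondeg (τ x)) (ξ ζ θ : E →L[𝕜] 𝕜) :
    jacobiator (fun x => sharp (τ x)) p ξ ζ θ =
      -extDeriv τ p ![sharp (τ p) ξ, sharp (τ p) ζ, sharp (τ p) θ] := by
  rw [extDeriv_two_apply, jacobiator]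
  simp only [apply_fderiv_sharp hτ hnd]
  ring

theorem flat_connecting {σ : E [⋀^Fin 2]→L[𝕜] 𝕜} (hσ : Nondeg σ) (σ₁ : E [⋀^Fin 2]→L[𝕜] 𝕜)
    (X : E) : flat σ (connecting σ σ₁ X) = flat σ₁ X := by
  ext Y
  rw [flat_apply, flat_apply, connecting_spec σ σ₁ hσ]

theorem flat_fderiv_secondForm {σ : E [⋀^Fin 2]→L[𝕜] 𝕜} (hσ : Nondeg σ)
    {τ : E → E [⋀^Fin 2]→L[𝕜] 𝕜} {p : E} (hτ : DifferentiableAt 𝕜 τ p) (v Y Z : E) :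
    flat (fderiv 𝕜 (fun x => secondForm σ (τ x)) p v) Y Z =
      flat (fderiv 𝕜 τ p v) (connecting σ (τ p) Y) Z +
        flat (fderiv 𝕜 τ p v) Y (connecting σ (τ p) Z) := by
  have hf : HasFDerivAt (fun x => flat (τ x)) _ p :=
    hasFDerivAt_flat hτ.hasFDerivAt
  have hH : HasFDerivAt (fun x => connecting σ (τ x)) _ p :=
    (hasFDerivAt_const (flat σ).inverse p).clm_comp hf
  have hS : HasFDerivAt (fun x => flat σ ∘L connecting σ (τ x) ∘L connecting σ (τ x)) _ p :=
    (hasFDerivAt_const (flat σ) p).clm_comp (hH.clm_comp hH)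
  have hS' : DifferentiableAt 𝕜 (fun x => secondForm σ (τ x)) p := by
    simp only [secondForm_eq_halfAlternatize]
    exact ((ContinuousLinearMap.hasFDerivAt (E := E →L[𝕜] E →L[𝕜] 𝕜) (F := E [⋀^Fin 2]→L[𝕜] 𝕜)
      (halfAlternatize 𝕜 E)).comp p hS).differentiableAt
  have hf' : HasFDerivAt (fun x => flat (secondForm σ (τ x))) _ p :=
    hasFDerivAt_flat hS'.hasFDerivAt
  simp only [flat_secondForm] at hf'
  have h := congrArg (fun L => L v Y Z) (hf'.unique hS)
  have hinv : ∀ X, flat σ ((flat σ).inverse X) = X := fun X => by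
    obtain ⟨e, he⟩ := flat_isInvertible σ hσ
    simp [← he]
  simp [flatCLM_apply, hinv, flat_connecting hσ] at h
  rw [h, add_comm, form_swap (τ p), ← flat_connecting hσ (τ p) Z, ← form_swap, hinv]

/-- For `σ` constant and `τ` closed, the Jacobiator of the sum of the inverse bivectors is the
exterior derivative of the `2`-form `τ(σ⁻¹ τ ·, ·)`. -/
theorem jacobiator_sharp_add {σ : E [⋀^Fin 2]→L[𝕜] 𝕜} (hσ : Nondeg σ)
    {τ : E → E [⋀^Fin 2]→L[𝕜] 𝕜} {p : E} (hτ : ContDiffAt 𝕜 1 τ p)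
    (hnd : ∀ᶠ x in 𝓝 p, Nondeg (τ x)) (hclosed : extDeriv τ p = 0) (ξ ζ θ : E →L[𝕜] 𝕜) :
    jacobiator (fun x => sharp σ + sharp (τ x)) p ξ ζ θ =
      extDeriv (fun x => secondForm σ (τ x)) p
        ![sharp (τ p) ξ, sharp (τ p) ζ, sharp (τ p) θ] := by
  have hp := hnd.self_of_nhds
  have hd := hτ.differentiableAt (by simp)
  have hfd : fderiv 𝕜 (fun x => sharp σ + sharp (τ x)) p = fderiv 𝕜 (fun x => sharp (τ x)) p :=
    fderiv_const_add (𝕜 := 𝕜) (E := E) (F := (E →L[𝕜] 𝕜) →L[𝕜] E) (x := p)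
      (f := fun x => sharp (τ x)) (sharp σ)
  have hc : ∀ X Y Z, flat (fderiv 𝕜 τ p X) Y Z + flat (fderiv 𝕜 τ p Y) Z X +
      flat (fderiv 𝕜 τ p Z) X Y = 0 := fun X Y Z => by
    rw [← extDeriv_two_apply, hclosed]
    rfl
  rw [extDeriv_two_apply, jacobiator, hfd]
  simp only [apply_fderiv_sharp hτ hnd, flat_fderiv_secondForm hσ hd, connecting_sharp hp,
    add_apply, map_add]
  have h0 := hc (sharp (τ p) ξ) (sharp (τ p) ζ) (sharp (τ p) θ)
  have h1 := hc (sharp σ ξ) (sharp (τ p) ζ) (sharp (τ p) θ)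
  have h2 := hc (sharp (τ p) ξ) (sharp σ ζ) (sharp (τ p) θ)
  have h3 := hc (sharp (τ p) ξ) (sharp (τ p) ζ) (sharp σ θ)
  linear_combination -h0 - h1 - h2 - h3

end Symplectic

/-! ### Exterior products with independent covectors -/

section Wedge

variable {𝕜 : Type*} [RCLike 𝕜]
variable {E : Type*} [NormedAddCommGroup E] [NormedSpace 𝕜 E]
variable {F : Type*} [NormedAddCommGroup F] [NormedSpace 𝕜 F]

theorem mem_commonKer {r : ℕ} {η : Fin r → E →L[𝕜] 𝕜} {v : E} :
    v ∈ commonKer η ↔ ∀ k, η k v = 0 := by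
  simp [commonKer]

theorem wedgeOne_apply {k : ℕ} (ξ : E →L[𝕜] 𝕜) (θ : E [⋀^Fin k]→L[𝕜] 𝕜) (v : Fin (k + 1) → E) :
    wedgeOne ξ θ v = ∑ i : Fin (k + 1), (-1) ^ (i : ℕ) • (ξ (v i) * θ (i.removeNth v)) := by
  rw [wedgeOne, ContinuousAlternatingMap.alternatizeUncurryFin_apply]
  simp

theorem wedgeOne_comp {k : ℕ} (ξ : E →L[𝕜] 𝕜) (θ : E [⋀^Fin k]→L[𝕜] 𝕜) (f : F →L[𝕜] E) :
    (wedgeOne ξ θ).compContinuousLinearMap f =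
      wedgeOne (ξ ∘L f) (θ.compContinuousLinearMap f) := by
  ext v
  rw [ContinuousAlternatingMap.compContinuousLinearMap_apply, wedgeOne_apply, wedgeOne_apply]
  rfl

theorem wedgeAll_comp {k : ℕ} : (r : ℕ) → (ξ : Fin r → E →L[𝕜] 𝕜) →
    (θ : E [⋀^Fin k]→L[𝕜] 𝕜) → (f : F →L[𝕜] E) →
    (wedgeAll r ξ θ).compContinuousLinearMap f =
      wedgeAll r (fun i => ξ i ∘L f) (θ.compContinuousLinearMap f)
  | 0, _, _, _ => rfl
  | r + 1, ξ, θ, f => by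
    rw [wedgeAll, wedgeAll, ← wedgeAll_comp r]
    exact wedgeOne_comp _ _ _

/-- `ξ ∧ θ = 0` exactly when `θ` vanishes on `ker ξ`: both sides are tested on a basis made of a
basis of `ker ξ` and one further vector. -/
theorem wedgeOne_eq_zero_iff [FiniteDimensional 𝕜 E] {k : ℕ} {ξ : E →L[𝕜] 𝕜} (hξ : ξ ≠ 0)
    (θ : E [⋀^Fin k]→L[𝕜] 𝕜) : wedgeOne ξ θ = 0 ↔
      θ.compContinuousLinearMap (LinearMap.ker (ξ : E →ₗ[𝕜] 𝕜)).subtypeL = 0 := by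
  obtain ⟨e, he⟩ : ∃ e, ξ e = 1 := by
    obtain ⟨e, he⟩ := DFunLike.ne_iff.1 hξ
    exact ⟨(ξ e)⁻¹ • e, by simpa using inv_mul_cancel₀ (by simpa using he)⟩
  constructor
  · intro h
    ext v
    have h1 := congrArg (fun Θ => Θ (Fin.cons e (fun i => (v i : E)))) h
    simp only [wedgeOne_apply, Fin.sum_univ_succ] at h1
    have hv : ∀ i, ξ (v i) = 0 := fun i => (v i).2
    simpa [he, hv, Function.comp_def] using h1
  · intro h
    let b := Module.Basis.mkFinCons e (Module.finBasis 𝕜 (LinearMap.ker (ξ : E →ₗ[𝕜] 𝕜)))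
      (fun c x hx hc => by
        have h1 := congrArg ξ hc
        have h2 : ξ x = 0 := hx
        simpa [he, h2] using h1)
      (fun z => ⟨-ξ z, by simp [he]⟩)
    have hb : ∀ i, b i ≠ e → ξ (b i) = 0 := by
      intro i
      refine Fin.cases (fun h0 => absurd (by simp [b]) h0) (fun i _ => ?_) i
      have : b i.succ = (Module.finBasis 𝕜 (LinearMap.ker (ξ : E →ₗ[𝕜] 𝕜)) i : E) := by
        simp [b]
      rw [this]
      exact (Module.finBasis 𝕜 (LinearMap.ker (ξ : E →ₗ[𝕜] 𝕜)) i).2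
    apply ContinuousAlternatingMap.toAlternatingMap_injective
    refine b.ext_alternating fun v hv => ?_
    change wedgeOne ξ θ (fun i => b (v i)) = 0
    rw [wedgeOne_apply]
    refine Finset.sum_eq_zero fun i _ => ?_
    by_cases hi : b (v i) = e
    · have hj : ∀ j, ξ (b (v (i.succAbove j))) = 0 := fun j => hb _ fun hj =>
        Fin.succAbove_ne i j (hv (b.injective (hj.trans hi.symm)))
      have h1 : θ (i.removeNth fun i => b (v i)) = 0 :=
        congrArg (fun Θ => Θ (fun j => (⟨b (v (i.succAbove j)), hj j⟩ :
          LinearMap.ker (ξ : E →ₗ[𝕜] 𝕜)))) h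
      simp [h1]
    · simp [hb _ hi]

theorem wedgeAll_eq_zero_iff [FiniteDimensional 𝕜 E] {k r : ℕ} {ξ : Fin r → E →L[𝕜] 𝕜}
    (hξ : LinearIndependent 𝕜 ξ) (θ : E [⋀^Fin k]→L[𝕜] 𝕜) :
    wedgeAll r ξ θ = 0 ↔ ∀ v : Fin k → E, (∀ i, v i ∈ commonKer ξ) → θ v = 0 := by
  induction r generalizing E with
  | zero =>
    simp only [mem_commonKer, IsEmpty.forall_iff, implies_true, forall_const]
    exact ⟨fun h v => congrArg (fun Θ => Θ v) h, fun h => by ext v; exact h v⟩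
  | succ r ih =>
    have h0 : ξ 0 ≠ 0 := hξ.ne_zero 0
    obtain ⟨e, he⟩ : ∃ e, ξ 0 e = 1 := by
      obtain ⟨e, he⟩ := DFunLike.ne_iff.1 h0
      exact ⟨(ξ 0 e)⁻¹ • e, by simpa using inv_mul_cancel₀ (by simpa using he)⟩
    have hind : LinearIndependent 𝕜 (fun i : Fin r =>
        ξ i.succ ∘L (LinearMap.ker (ξ 0 : E →ₗ[𝕜] 𝕜)).subtypeL) := by
      rw [Fintype.linearIndependent_iff] at hξ ⊢
      intro c hc i
      refine hξ (Fin.cons (-∑ i, c i * ξ i.succ e) c) ?_ i.succ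
      ext v
      have h1 := congrArg (fun L => L ⟨v - ξ 0 v • e, by simp [he]⟩) hc
      simp [mul_sub, Finset.sum_sub_distrib] at h1
      have h2 : ∑ x, c x * (ξ 0 v * ξ x.succ e) = (∑ x, c x * ξ x.succ e) * ξ 0 v := by
        rw [Finset.sum_mul]
        exact Finset.sum_congr rfl fun x _ => by ring
      simp [Fin.sum_univ_succ]
      linear_combination h1 + h2
    rw [wedgeAll, wedgeOne_eq_zero_iff h0, wedgeAll_comp, ih hind]
    constructor
    · intro h v hv
      simp only [mem_commonKer] at hv
      exact h (fun i => ⟨v i, hv i 0⟩) fun i => mem_commonKer.2 fun l => hv i l.succ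
    · intro h v hv
      simp only [mem_commonKer] at hv
      exact h (fun i => (v i : E)) fun i => mem_commonKer.2 fun l =>
        Fin.cases (v i).2 (fun l => hv i l) l

/-- A map with the defining property of `leafSharp` is `leafSharp`. Its existence forces the
restriction of the `2`-form to the common kernel to be nondegenerate. -/
theorem leafSharp_eq [FiniteDimensional 𝕜 E] {r : ℕ} {η : Fin r → E →L[𝕜] 𝕜}
    {σ : E [⋀^Fin 2]→L[𝕜] 𝕜} {K : (E →L[𝕜] 𝕜) →L[𝕜] E} (hK : ∀ ξ, K ξ ∈ commonKer η)
    (hσ : ∀ ξ, ∀ Y ∈ commonKer η, flat σ (K ξ) Y = -ξ Y) : leafSharp η σ = K := by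
  have huniq : ∀ v ∈ commonKer η, (∀ Y ∈ commonKer η, flat σ v Y = 0) → v = 0 := by
    intro v hv h
    by_contra hne
    obtain ⟨ξ, hξ⟩ := SeparatingDual.exists_ne_zero (R := 𝕜) hne
    refine hξ ?_
    rw [← neg_eq_zero, ← hσ ξ v hv, form_swap, h _ (hK ξ), neg_zero]
  have hnd : Nondeg (restrictKer η σ) := by
    intro X hX
    refine Subtype.ext (huniq X X.2 fun Y hY => ?_)
    rw [flat_apply, ← hX ⟨Y, hY⟩, restrictKer,
      ContinuousAlternatingMap.compContinuousLinearMap_apply]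
    congr 1
    funext i; fin_cases i <;> rfl
  ext1 ξ
  obtain ⟨h1, h2⟩ := leafSharp_spec η σ hnd ξ
  rw [← sub_eq_zero]
  refine huniq _ (Submodule.sub_mem _ h1 (hK ξ)) fun Y hY => ?_
  rw [map_sub, sub_apply, hσ ξ Y hY, flat_apply, h2 Y hY, sub_self]

end Wedge

/-! ### The symplectic forms of the local model and their reduction -/

section Reduction

variable {𝕜 : Type*} [RCLike 𝕜] {q r m : ℕ}

/-- The form `∑ b_j dx_j ∧ dy_j + γ` on `M × 𝕜^r`, where `γ` is the pull-back of a `2`-form on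
`P`. Both `Ω` and `Ω₁` are of this shape. -/
def modelForm (b : Fin q ⊕ Fin r → 𝕜)
    (γ : PSpace 𝕜 q r m → PSpace 𝕜 q r m [⋀^Fin 2]→L[𝕜] 𝕜) :
    TSpace 𝕜 q r m → TSpace 𝕜 q r m [⋀^Fin 2]→L[𝕜] 𝕜 := fun p =>
  ∑ j, b j • wedgeOne (dx j) (oneForm (dy j)) +
    (γ (projP (projM p))).compContinuousLinearMap (projP ∘L projM)

theorem flat_comp {E F : Type*} [NormedAddCommGroup E] [NormedSpace 𝕜 E]
    [NormedAddCommGroup F] [NormedSpace 𝕜 F] (σ : E [⋀^Fin 2]→L[𝕜] 𝕜) (f : F →L[𝕜] E) (X Y : F) :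
    flat (σ.compContinuousLinearMap f) X Y = flat σ (f X) (f Y) := by
  rw [flat_apply, flat_apply, ContinuousAlternatingMap.compContinuousLinearMap_apply]
  congr 1
  funext i; fin_cases i <;> rfl

theorem flat_modelForm (b : Fin q ⊕ Fin r → 𝕜)
    (γ : PSpace 𝕜 q r m → PSpace 𝕜 q r m [⋀^Fin 2]→L[𝕜] 𝕜) (p X Y : TSpace 𝕜 q r m) :
    flat (modelForm b γ p) X Y =
      ∑ j, b (Sum.inl j) * (X.1.1 (Sum.inl j) * Y.1.2.1 j - X.1.2.1 j * Y.1.1 (Sum.inl j)) +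
      ∑ l, b (Sum.inr l) * (X.1.1 (Sum.inr l) * Y.2 l - X.2 l * Y.1.1 (Sum.inr l)) +
      flat (γ (p.1.1, p.1.2.2)) (X.1.1, X.1.2.2) (Y.1.1, Y.1.2.2) := by
  rw [modelForm, flat_add_apply, flat_sum_apply, flat_comp, Fintype.sum_sum_type]
  have h : ∀ j, flat (b j • wedgeOne (dx j) (oneForm (dy j)) : TSpace 𝕜 q r m [⋀^Fin 2]→L[𝕜] 𝕜)
      X Y = b j * (dx j X * dy j Y - dy j X * dx j Y) := fun j =>
    (flat_smul_apply _ _ _ _).trans (congrArg (b j * ·) (flat_wedgeOne _ _ _ _))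
  exact congrArg₂ (· + ·) (congrArg₂ (· + ·) (Finset.sum_congr rfl fun j _ => h (Sum.inl j))
    (Finset.sum_congr rfl fun l _ => h (Sum.inr l))) rfl

/-- The inclusion of the `y`-directions in the space of `(x, y, z)`. -/
def embY : (Fin q → 𝕜) →L[𝕜] MSpace 𝕜 q r m :=
  ContinuousLinearMap.inr 𝕜 _ _ ∘L ContinuousLinearMap.inl 𝕜 _ _

variable (𝕜 q r) in
/-- The transpose of a map `L : 𝕜^n → 𝕜^r`, followed by the projection to the first `n - r`
coordinates: `(shear L u)_j = ∑ l, u_l L(e_j)_l`. -/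
def shear : (NSpace 𝕜 q r →L[𝕜] (Fin r → 𝕜)) →L[𝕜] (Fin r → 𝕜) →L[𝕜] (Fin q → 𝕜) :=
  ∑ l, ∑ j, (ContinuousLinearMap.proj l ∘L
      ContinuousLinearMap.apply 𝕜 (Fin r → 𝕜) (Pi.single (Sum.inl j) 1 : NSpace 𝕜 q r) :
      (NSpace 𝕜 q r →L[𝕜] (Fin r → 𝕜)) →L[𝕜] 𝕜).smulRight
    ((ContinuousLinearMap.proj l : (Fin r → 𝕜) →L[𝕜] 𝕜).smulRight
      (Pi.single j 1 : Fin q → 𝕜))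

theorem shear_apply (L : NSpace 𝕜 q r →L[𝕜] (Fin r → 𝕜)) (u : Fin r → 𝕜) (j : Fin q) :
    shear 𝕜 q r L u j = ∑ l, u l * L (Pi.single (Sum.inl j) 1) l := by
  simp [shear, _root_.sum_apply, Finset.sum_apply, Pi.single_apply, mul_comm]

theorem sum_mul_apply_eq (L : NSpace 𝕜 q r →L[𝕜] (Fin r → 𝕜)) (u : Fin r → 𝕜)
    (V : NSpace 𝕜 q r) : ∑ l, u l * L V l =
      ∑ j, V (Sum.inl j) * shear 𝕜 q r L u j + ∑ l, u l * L (Sum.elim 0 (V ∘ Sum.inr)) l := by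
  have hV : V = ∑ j, V (Sum.inl j) • (Pi.single (Sum.inl j) 1 : NSpace 𝕜 q r) +
      Sum.elim (0 : Fin q → 𝕜) (V ∘ Sum.inr) := by
    funext i
    rcases i with i | i <;> simp [Finset.sum_apply, Pi.single_apply]
  conv_lhs => rw [hV]
  simp only [map_add, map_sum, map_smul, Pi.add_apply, Finset.sum_apply, Pi.smul_apply, mul_add,
    Finset.sum_add_distrib, shear_apply, Finset.mul_sum, smul_eq_mul]
  rw [Finset.sum_comm]
  congr 1
  exact Finset.sum_congr rfl fun _ _ => Finset.sum_congr rfl fun _ _ => by ring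

/-- A field `κ` of maps `𝕜^n → 𝕜^r` on `N`, that is, `r` one-forms `κ_l`, normalised by
`κ_l = dx_{n-r+l}` on the last `r` directions, such that the `1`-forms `κ_l ∘ diag b` are closed
on their common kernel; the last `r` entries of `b` coincide. -/
structure IsAdapted (κ : NSpace 𝕜 q r → (NSpace 𝕜 q r →L[𝕜] (Fin r → 𝕜)))
    (b : Fin q ⊕ Fin r → 𝕜) (c : 𝕜) (N : Set (NSpace 𝕜 q r)) : Prop where
  smooth : ContDiffOn 𝕜 ∞ κ N
  normalised : ∀ x ∈ N, ∀ u : Fin r → 𝕜, κ x (Sum.elim 0 u) = u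
  last : ∀ l, b (Sum.inr l) = c
  integrable : ∀ x ∈ N, ∀ X Y : NSpace 𝕜 q r, κ x (b * X) = 0 → κ x (b * Y) = 0 →
    fderiv 𝕜 κ x X (b * Y) = fderiv 𝕜 κ x Y (b * X)

/-- The map `(x, y, z, y') ↦ (x, y - S(x) y', z)` from `M × 𝕜^r` to the `(x, y, z)`-space, where
`S(x) = shear (κ x)`. -/
def reduction (κ : NSpace 𝕜 q r → (NSpace 𝕜 q r →L[𝕜] (Fin r → 𝕜)))
    (p : TSpace 𝕜 q r m) : MSpace 𝕜 q r m :=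
  projM p - embY (shear 𝕜 q r (κ (projN (projM p))) p.2)

theorem reduction_inclM (κ : NSpace 𝕜 q r → (NSpace 𝕜 q r →L[𝕜] (Fin r → 𝕜)))
    (p : MSpace 𝕜 q r m) : reduction κ (inclM p) = p := by
  have h2 : (inclM p).2 = 0 := rfl
  rw [reduction, h2, map_zero, map_zero, sub_zero]
  rfl

theorem contDiffAt_reduction {κ : NSpace 𝕜 q r → (NSpace 𝕜 q r →L[𝕜] (Fin r → 𝕜))}
    {p : TSpace 𝕜 q r m} (hκ : ContDiffAt 𝕜 ∞ κ p.1.1) : ContDiffAt 𝕜 ∞ (reduction κ) p := by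
  have h1 : ContDiffAt 𝕜 ∞ (fun p : TSpace 𝕜 q r m => shear 𝕜 q r (κ (projN (projM p)))) p :=
    ContDiffAt.comp p (shear 𝕜 q r).contDiff.contDiffAt (ContDiffAt.comp p hκ
      (projN ∘L projM : TSpace 𝕜 q r m →L[𝕜] NSpace 𝕜 q r).contDiff.contDiffAt)
  exact projM.contDiff.contDiffAt.sub
    (embY.contDiff.contDiffAt.comp p (h1.clm_apply contDiff_snd.contDiffAt))

theorem fderiv_reduction {κ : NSpace 𝕜 q r → (NSpace 𝕜 q r →L[𝕜] (Fin r → 𝕜))}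
    {p : TSpace 𝕜 q r m} (hκ : DifferentiableAt 𝕜 κ p.1.1) (U : TSpace 𝕜 q r m) :
    fderiv 𝕜 (reduction κ) p U =
      U.1 - embY (shear 𝕜 q r (κ p.1.1) U.2 + shear 𝕜 q r (fderiv 𝕜 κ p.1.1 U.1.1) p.2) := by
  have h0 : HasFDerivAt (fun p : TSpace 𝕜 q r m => κ (projN (projM p))) _ p :=
    HasFDerivAt.comp p hκ.hasFDerivAt
      (projN ∘L projM : TSpace 𝕜 q r m →L[𝕜] NSpace 𝕜 q r).hasFDerivAt
  have h1 : HasFDerivAt (fun p : TSpace 𝕜 q r m => shear 𝕜 q r (κ (projN (projM p)))) _ p :=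
    HasFDerivAt.comp p (shear 𝕜 q r).hasFDerivAt h0
  have h2 : HasFDerivAt (reduction κ) _ p := projM.hasFDerivAt.sub
    (embY.hasFDerivAt.comp p (h1.clm_apply hasFDerivAt_snd))
  rw [h2.fderiv]
  rfl

variable {N : Set (NSpace 𝕜 q r)} {κ : NSpace 𝕜 q r → (NSpace 𝕜 q r →L[𝕜] (Fin r → 𝕜))}
  {b : Fin q ⊕ Fin r → 𝕜} {c : 𝕜}

theorem IsAdapted.contDiffAt (h : IsAdapted κ b c N) (hN : IsOpen N) {x : NSpace 𝕜 q r}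
    (hx : x ∈ N) : ContDiffAt 𝕜 ∞ κ x := h.smooth.contDiffAt (hN.mem_nhds hx)

theorem IsAdapted.differentiableAt (h : IsAdapted κ b c N) (hN : IsOpen N) {x : NSpace 𝕜 q r}
    (hx : x ∈ N) : DifferentiableAt 𝕜 κ x := (h.contDiffAt hN hx).differentiableAt (by simp)

theorem IsAdapted.fderiv_elim (h : IsAdapted κ b c N) (hN : IsOpen N) {x : NSpace 𝕜 q r}
    (hx : x ∈ N) (W : NSpace 𝕜 q r) (u : Fin r → 𝕜) :
    fderiv 𝕜 κ x W (Sum.elim 0 u) = 0 := by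
  have h1 := (h.differentiableAt hN hx).hasFDerivAt.clm_apply
    (hasFDerivAt_const (Sum.elim 0 u : NSpace 𝕜 q r) x)
  have h2 := h1.unique ((hasFDerivAt_const u x).congr_of_eventuallyEq
    (Filter.mem_of_superset (hN.mem_nhds hx) fun y hy => h.normalised y hy u))
  simpa using congrArg (fun L => L W) h2

/-- The values `κ_l(b V)` in terms of `shear`: the sum over the last `r` coordinates comes from the
normalisation of `κ`. -/
theorem IsAdapted.sum_mul_apply (h : IsAdapted κ b c N) {x : NSpace 𝕜 q r}
    (hx : x ∈ N) (u : Fin r → 𝕜) (V : NSpace 𝕜 q r) : ∑ l, u l * κ x (b * V) l =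
      ∑ j, b (Sum.inl j) * V (Sum.inl j) * shear 𝕜 q r (κ x) u j +
        ∑ l, c * u l * V (Sum.inr l) := by
  rw [sum_mul_apply_eq, h.normalised x hx]
  congr 1
  refine Finset.sum_congr rfl fun l _ => ?_
  simp [h.last]
  ring

theorem IsAdapted.sum_mul_fderiv_apply (h : IsAdapted κ b c N) (hN : IsOpen N)
    {x : NSpace 𝕜 q r} (hx : x ∈ N) (u : Fin r → 𝕜) (W V : NSpace 𝕜 q r) :
    ∑ l, u l * fderiv 𝕜 κ x W (b * V) l =
      ∑ j, b (Sum.inl j) * V (Sum.inl j) * shear 𝕜 q r (fderiv 𝕜 κ x W) u j := by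
  rw [sum_mul_apply_eq, h.fderiv_elim hN hx]
  simp

/-- The vector `((0, S(x) u, 0), u)` spans the kernel of the derivative of `reduction κ` as `u`
varies. -/
theorem IsAdapted.flat_modelForm_vertical (h : IsAdapted κ b c N)
    (γ : PSpace 𝕜 q r m → PSpace 𝕜 q r m [⋀^Fin 2]→L[𝕜] 𝕜) {p : TSpace 𝕜 q r m}
    (hp : p.1.1 ∈ N) (X : TSpace 𝕜 q r m) (u : Fin r → 𝕜) :
    flat (modelForm b γ p) X ((0, shear 𝕜 q r (κ p.1.1) u, 0), u) =
      ∑ l, u l * κ p.1.1 (b * X.1.1) l := by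
  have h3 : flat (γ (p.1.1, p.1.2.2)) (X.1.1, X.1.2.2) (0, 0) = 0 := map_zero _
  rw [flat_modelForm, h.sum_mul_apply hp]
  simp only [h.last, Pi.zero_apply, mul_zero, sub_zero]
  rw [h3, add_zero]
  congr 1 <;> exact Finset.sum_congr rfl fun _ _ => by ring

/-- Testing against the kernel of the derivative `D` of `reduction κ`: the inverse of
`modelForm b γ` maps the covectors `ξ ∘ D` to vectors killed by the forms `κ_l ∘ diag b`. -/
theorem IsAdapted.apply_sharp_eq_zero (h : IsAdapted κ b c N) (hN : IsOpen N)
    {γ : PSpace 𝕜 q r m → PSpace 𝕜 q r m [⋀^Fin 2]→L[𝕜] 𝕜} {p : TSpace 𝕜 q r m}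
    (hp : p.1.1 ∈ N) (hnd : Nondeg (modelForm b γ p)) (ξ : MSpace 𝕜 q r m →L[𝕜] 𝕜) :
    κ p.1.1 (b * (sharp (modelForm b γ p) (ξ ∘L fderiv 𝕜 (reduction κ) p)).1.1) = 0 := by
  funext l
  have h1 := h.flat_modelForm_vertical γ hp
    (sharp (modelForm b γ p) (ξ ∘L fderiv 𝕜 (reduction κ) p)) (Pi.single l 1)
  have h0 : fderiv 𝕜 (reduction (m := m) κ) p
      ((0, shear 𝕜 q r (κ p.1.1) (Pi.single l 1), 0), Pi.single l 1) = 0 := by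
    rw [fderiv_reduction (h.differentiableAt hN hp)]
    simp [embY]
  rw [flat_sharp hnd, neg_apply, ContinuousLinearMap.comp_apply, h0, map_zero, neg_zero] at h1
  simpa [Pi.single_apply] using h1.symm

/-- Over `M × {0}`, every vector killed by the forms `κ_l ∘ diag b` is the image of a covector
`ξ ∘ D`, where `D` is the derivative of `reduction κ`. -/
theorem IsAdapted.exists_sharp_eq (h : IsAdapted κ b c N) (hN : IsOpen N)
    {γ : PSpace 𝕜 q r m → PSpace 𝕜 q r m [⋀^Fin 2]→L[𝕜] 𝕜} {p : MSpace 𝕜 q r m}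
    (hp : p.1 ∈ N) (hnd : Nondeg (modelForm b γ (inclM p))) {X : TSpace 𝕜 q r m}
    (hX : κ p.1 (b * X.1.1) = 0) : ∃ ξ : MSpace 𝕜 q r m →L[𝕜] 𝕜,
      sharp (modelForm b γ (inclM p)) (ξ ∘L fderiv 𝕜 (reduction κ) (inclM p)) = X := by
  refine ⟨-(flat (modelForm b γ (inclM p)) X ∘L inclM), ?_⟩
  have hc : (-(flat (modelForm b γ (inclM p)) X ∘L inclM)) ∘L
      fderiv 𝕜 (reduction κ) (inclM p) = -flat (modelForm b γ (inclM p)) X := by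
    refine ContinuousLinearMap.ext fun U => ?_
    have h1 := h.flat_modelForm_vertical γ (p := inclM p) hp X U.2
    have hX' : κ (inclM p : TSpace 𝕜 q r m).1.1 (b * X.1.1) = 0 := hX
    rw [hX'] at h1
    simp only [Pi.zero_apply, mul_zero, Finset.sum_const_zero] at h1
    have hU : U = inclM (fderiv 𝕜 (reduction κ) (inclM p) U) +
        ((0, shear 𝕜 q r (κ (inclM p : TSpace 𝕜 q r m).1.1) U.2, 0), U.2) := by
      rw [fderiv_reduction (h.differentiableAt hN hp)]
      have h2 : (inclM p : TSpace 𝕜 q r m).2 = 0 := rfl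
      rw [h2, map_zero, add_zero]
      ext <;> simp [inclM, embY]
    conv_rhs => rw [hU]
    rw [neg_apply, map_add, h1, add_zero]
    rfl
  rw [hc, map_neg, sharp_flat hnd, neg_neg]

/-- The bivector inverse to `modelForm b γ` is carried by `reduction κ` to the bivector given by
the `1`-forms `κ_l ∘ diag b` and the restriction of `modelForm b γ` to `M`. -/
theorem leafSharp_eq_reduction (h : IsAdapted κ b c N) (hN : IsOpen N)
    {γ : PSpace 𝕜 q r m → PSpace 𝕜 q r m [⋀^Fin 2]→L[𝕜] 𝕜} {p : TSpace 𝕜 q r m}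
    (hp : p.1.1 ∈ N) (hnd : Nondeg (modelForm b γ p)) {s : ℕ}
    {η : Fin s → MSpace 𝕜 q r m →L[𝕜] 𝕜}
    (hη : ∀ v, v ∈ commonKer η ↔ κ p.1.1 (b * v.1) = 0) :
    leafSharp η ((modelForm b γ (inclM (reduction κ p))).compContinuousLinearMap inclM) =
      fderiv 𝕜 (reduction κ) p ∘L sharp (modelForm b γ p) ∘L
        ContinuousLinearMap.precomp 𝕜 (fderiv 𝕜 (reduction κ) p) := by
  have hκ := h.differentiableAt hN hp
  have hD := fun U => fderiv_reduction (m := m) hκ U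
  set D := fderiv 𝕜 (reduction (m := m) κ) p
  have hX : ∀ (ξ : MSpace 𝕜 q r m →L[𝕜] 𝕜) U,
      flat (modelForm b γ p) (sharp (modelForm b γ p) (ξ ∘L D)) U = -ξ (D U) := fun ξ U => by
    rw [flat_sharp hnd]; rfl
  have hD1 : ∀ U, (D U).1 = U.1.1 := fun U => by rw [hD]; simp [embY]
  have hDy : ∀ U j, (D U).2.1 j = U.1.2.1 j -
      (shear 𝕜 q r (κ p.1.1) U.2 j + shear 𝕜 q r (fderiv 𝕜 κ p.1.1 U.1.1) p.2 j) := fun U j => by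
    rw [hD]; simp [embY]
  have hDz : ∀ U, (D U).2.2 = U.1.2.2 := fun U => by rw [hD]; simp [embY]
  have hker : ∀ ξ : MSpace 𝕜 q r m →L[𝕜] 𝕜,
      κ p.1.1 (b * (sharp (modelForm b γ p) (ξ ∘L D)).1.1) = 0 := fun ξ =>
    h.apply_sharp_eq_zero hN hp hnd ξ
  refine leafSharp_eq (fun ξ => ?_) fun ξ Y hY => ?_
  · rw [hη]
    change κ p.1.1 (b * (D _).1) = 0
    rw [hD1]
    exact hker ξ
  · rw [hη] at hY
    have hXk := hker ξ
    -- `D` maps this vector to `Y`.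
    let U : TSpace 𝕜 q r m := (Y + embY (shear 𝕜 q r (fderiv 𝕜 κ p.1.1 Y.1) p.2), 0)
    have h0 : D U = Y := by
      rw [hD]
      simp [U, embY]
    have h1 := hX ξ U
    rw [h0] at h1
    rw [← h1, flat_comp]
    change flat _ (inclM (D (sharp (modelForm b γ p) (ξ ∘L D)))) (inclM Y) = _
    generalize sharp (modelForm b γ p) (ξ ∘L D) = X at hXk ⊢
    have e1 := h.sum_mul_apply hp X.2 Y.1
    have e2 := h.sum_mul_fderiv_apply hN hp p.2 X.1.1 Y.1
    have e3 := h.sum_mul_fderiv_apply hN hp p.2 Y.1 X.1.1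
    rw [h.integrable _ hp X.1.1 Y.1 hXk hY, e3] at e2
    rw [hY] at e1
    simp only [Pi.zero_apply, mul_zero, Finset.sum_const_zero] at e1
    rw [flat_modelForm, flat_modelForm]
    have g1 : (reduction κ p).1 = p.1.1 := by simp [reduction, embY, projM, projN]
    have g2 : (reduction κ p).2.2 = p.1.2.2 := by simp [reduction, embY, projM, projN]
    have i1 : ∀ v : MSpace 𝕜 q r m, (inclM v).1 = v := fun _ => rfl
    have i2 : ∀ v : MSpace 𝕜 q r m, (inclM v).2 = 0 := fun _ => rfl
    have u1 : U.1.1 = Y.1 := by simp [U, embY]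
    have u2 : ∀ j, U.1.2.1 j = Y.2.1 j + shear 𝕜 q r (fderiv 𝕜 κ p.1.1 Y.1) p.2 j := fun j => by
      simp [U, embY]
    have u3 : U.1.2.2 = Y.2.2 := by simp [U, embY]
    have u4 : U.2 = 0 := rfl
    simp only [i1, i2, g1, g2, hD1, hDz, hDy, u1, u2, u3, u4, h.last, Pi.zero_apply]
    rw [add_left_inj]
    rw [← sub_eq_zero, add_sub_add_comm, ← Finset.sum_sub_distrib, ← Finset.sum_sub_distrib]
    have k1 : ∀ S T, S = ∑ j, b (Sum.inl j) * Y.1 (Sum.inl j) * shear 𝕜 q r (κ p.1.1) X.2 j +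
        ∑ j, b (Sum.inl j) * Y.1 (Sum.inl j) * shear 𝕜 q r (fderiv 𝕜 κ p.1.1 X.1.1) p.2 j -
        ∑ j, b (Sum.inl j) * X.1.1 (Sum.inl j) * shear 𝕜 q r (fderiv 𝕜 κ p.1.1 Y.1) p.2 j →
        T = ∑ l, c * X.2 l * Y.1 (Sum.inr l) → S + T = 0 := fun S T hS hT => by
      rw [hS, hT]
      linear_combination -e1 - e2
    refine k1 _ _ ?_ ?_
    · rw [← Finset.sum_add_distrib, ← Finset.sum_sub_distrib]
      exact Finset.sum_congr rfl fun _ _ => by ring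
    · exact Finset.sum_congr rfl fun _ _ => by ring

end Reduction

/-! ### The coframe of a Veronese web -/

section Coframe

variable {𝕜 : Type*} [RCLike 𝕜] {q r : ℕ} {a : Fin q → 𝕜} {a₀ : 𝕜}
  {α : Fin r → NSpace 𝕜 q r → (NSpace 𝕜 q r →L[𝕜] 𝕜)} {N : Set (NSpace 𝕜 q r)}
  {x : NSpace 𝕜 q r}

theorem tensorJ_apply (a : Fin q → 𝕜) (a₀ : 𝕜) (v : NSpace 𝕜 q r) :
    tensorJ a a₀ v = eig a a₀ * v := rfl

theorem IsVeroneseWeb.eig_ne_zero (hα : IsVeroneseWeb a a₀ α N) (j : Fin q ⊕ Fin r) :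
    eig a a₀ j ≠ 0 := by
  rcases j with j | j
  exacts [hα.ne_zero.1 j, hα.ne_zero.2]

theorem eig_inv (a : Fin q → 𝕜) (a₀ : 𝕜) : eig (r := r) a⁻¹ a₀⁻¹ = (eig a a₀)⁻¹ := by
  funext j
  rcases j with j | j <;> rfl

theorem IsVeroneseWeb.tensorJ_inv_apply (hα : IsVeroneseWeb a a₀ α N) (v : NSpace 𝕜 q r) :
    tensorJ a⁻¹ a₀⁻¹ (eig a a₀ * v) = v := by
  rw [tensorJ_apply, eig_inv]
  funext j
  exact inv_mul_cancel_left₀ (hα.eig_ne_zero j) _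

theorem IsVeroneseWeb.eig_mul_tensorJ_inv (hα : IsVeroneseWeb a a₀ α N) (v : NSpace 𝕜 q r) :
    eig a a₀ * tensorJ a⁻¹ a₀⁻¹ v = v := by
  rw [tensorJ_apply, eig_inv]
  funext j
  exact mul_inv_cancel_left₀ (hα.eig_ne_zero j) _

theorem IsVeroneseWeb.inverse_tensorJ (hα : IsVeroneseWeb a a₀ α N) :
    (tensorJ (r := r) a a₀).inverse = tensorJ a⁻¹ a₀⁻¹ :=
  ContinuousLinearMap.inverse_eq (ContinuousLinearMap.ext hα.eig_mul_tensorJ_inv)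
    (ContinuousLinearMap.ext hα.tensorJ_inv_apply)

/-- The covectors `α₁, …, α_r` as one map to `𝕜^r`. -/
def webMap (α : Fin r → NSpace 𝕜 q r → (NSpace 𝕜 q r →L[𝕜] 𝕜)) (x : NSpace 𝕜 q r) :
    NSpace 𝕜 q r →L[𝕜] (Fin r → 𝕜) := ContinuousLinearMap.pi fun k => α k x

variable (𝕜 q r) in
/-- The inclusion of the eigenspace of `J` of the eigenvalue `a`. -/
def inLast : (Fin r → 𝕜) →L[𝕜] NSpace 𝕜 q r :=
  ContinuousLinearMap.pi (Sum.elim (fun _ => 0) fun l => ContinuousLinearMap.proj l)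

theorem inLast_apply (u : Fin r → 𝕜) : inLast 𝕜 q r u = Sum.elim (0 : Fin q → 𝕜) u := by
  funext j
  rcases j with j | j <;> rfl

/-- The coefficients of `dx_{n-r+1}, …, dx_n` in `α₁, …, α_r`. -/
def webMatrix (α : Fin r → NSpace 𝕜 q r → (NSpace 𝕜 q r →L[𝕜] 𝕜)) (x : NSpace 𝕜 q r) :
    (Fin r → 𝕜) →L[𝕜] (Fin r → 𝕜) := webMap α x ∘L inLast 𝕜 q r

/-- The basis of the span of `α₁ ∘ J⁻¹, …, α_r ∘ J⁻¹` dual to the last `r` coordinate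
directions. -/
def coframe (a : Fin q → 𝕜) (a₀ : 𝕜) (α : Fin r → NSpace 𝕜 q r → (NSpace 𝕜 q r →L[𝕜] 𝕜))
    (x : NSpace 𝕜 q r) : NSpace 𝕜 q r →L[𝕜] (Fin r → 𝕜) :=
  a₀ • ((webMatrix α x).inverse ∘L webMap α x ∘L tensorJ a⁻¹ a₀⁻¹)

/-- The eigenspace of the eigenvalue `a` meets `ker α₁ ∩ … ∩ ker α_r` in a `J`-invariant
subspace, hence trivially. -/
theorem IsVeroneseWeb.webMatrix_isInvertible (hα : IsVeroneseWeb a a₀ α N) (hx : x ∈ N) :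
    (webMatrix α x).IsInvertible := by
  have hinj : Function.Injective (webMatrix α x) := by
    rw [injective_iff_map_eq_zero]
    intro u hu
    have h := hα.no_invariant x hx (Submodule.span 𝕜 {inLast 𝕜 q r u}) ?_ ?_
    · rw [Submodule.span_singleton_eq_bot, inLast_apply] at h
      funext l
      exact congrFun h (Sum.inr l)
    · rw [Submodule.span_singleton_le_iff_mem, mem_commonKer]
      exact fun k => congrFun hu k
    · intro w hw
      obtain ⟨s, rfl⟩ := Submodule.mem_span_singleton.1 hw
      refine Submodule.mem_span_singleton.2 ⟨a₀ * s, ?_⟩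
      rw [tensorJ_apply, inLast_apply]
      funext j
      rcases j with j | j <;> simp [eig, mul_assoc]
  exact ⟨(LinearEquiv.ofInjectiveEndo (webMatrix α x : (Fin r → 𝕜) →ₗ[𝕜] (Fin r → 𝕜))
    hinj).toContinuousLinearEquiv, by ext; rfl⟩

theorem IsVeroneseWeb.webMatrix_coframe (hα : IsVeroneseWeb a a₀ α N) (hx : x ∈ N)
    (v : NSpace 𝕜 q r) :
    webMatrix α x (coframe a a₀ α x v) = a₀ • webMap α x (tensorJ a⁻¹ a₀⁻¹ v) := by
  obtain ⟨e, he⟩ := hα.webMatrix_isInvertible hx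
  simp [coframe, ← he]

theorem IsVeroneseWeb.webMatrix_injective (hα : IsVeroneseWeb a a₀ α N) (hx : x ∈ N) :
    Function.Injective (webMatrix α x) := by
  obtain ⟨e, he⟩ := hα.webMatrix_isInvertible hx
  rw [← he]
  exact e.injective

theorem IsVeroneseWeb.coframe_eq_zero_iff (hα : IsVeroneseWeb a a₀ α N) (hx : x ∈ N)
    (v : NSpace 𝕜 q r) :
    coframe a a₀ α x v = 0 ↔ ∀ k, α k x (tensorJ a⁻¹ a₀⁻¹ v) = 0 := by
  rw [← (hα.webMatrix_injective hx).eq_iff, map_zero, hα.webMatrix_coframe hx,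
    smul_eq_zero_iff_right hα.ne_zero.2, funext_iff]
  rfl

theorem IsVeroneseWeb.contDiffOn_webMap (hα : IsVeroneseWeb a a₀ α N) :
    ContDiffOn 𝕜 ∞ (webMap α) N :=
  contDiffOn_clm_apply.2 fun _ => contDiffOn_pi.2 fun k =>
    (hα.smooth k).clm_apply contDiffOn_const

theorem IsVeroneseWeb.contDiffOn_coframe (hα : IsVeroneseWeb a a₀ α N) :
    ContDiffOn 𝕜 ∞ (coframe a a₀ α) N := by
  intro x hx
  have h1 := hα.contDiffOn_webMap x hx
  have h2 : ContDiffWithinAt 𝕜 ∞ (webMatrix α) N x := h1.clm_comp contDiffWithinAt_const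
  have h3 : ContDiffWithinAt 𝕜 ∞ (fun x => (webMatrix α x).inverse) N x :=
    ContDiffAt.comp_contDiffWithinAt x (g := ContinuousLinearMap.inverse)
      (hα.webMatrix_isInvertible hx).contDiffAt_map_inverse h2
  exact (h3.clm_comp (h1.clm_comp contDiffWithinAt_const)).const_smul a₀

theorem IsVeroneseWeb.coframe_normalised (hα : IsVeroneseWeb a a₀ α N) (hx : x ∈ N)
    (u : Fin r → 𝕜) : coframe a a₀ α x (Sum.elim 0 u) = u := by
  apply hα.webMatrix_injective hx
  rw [hα.webMatrix_coframe hx, ← map_smul]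
  have h : a₀ • tensorJ a⁻¹ a₀⁻¹ (Sum.elim 0 u) = inLast 𝕜 q r u := by
    rw [inLast_apply, tensorJ_apply]
    funext j
    rcases j with j | j <;> simp [eig, hα.ne_zero.2]
  rw [h]
  rfl

/-- The derivative of the coframe on its kernel, from `webMatrix ∘ coframe = a₀ • α ∘ J⁻¹`. -/
theorem IsVeroneseWeb.webMatrix_fderiv_coframe (hα : IsVeroneseWeb a a₀ α N) (hN : IsOpen N)
    (hx : x ∈ N) (X : NSpace 𝕜 q r) {V : NSpace 𝕜 q r} (hV : coframe a a₀ α x V = 0) :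
    webMatrix α x (fderiv 𝕜 (coframe a a₀ α) x X V) =
      a₀ • fun k => fderiv 𝕜 (α k) x X (tensorJ a⁻¹ a₀⁻¹ V) := by
  have hW : DifferentiableAt 𝕜 (webMap α) x :=
    (hα.contDiffOn_webMap.contDiffAt (hN.mem_nhds hx)).differentiableAt (by simp)
  have hκ : DifferentiableAt 𝕜 (coframe a a₀ α) x :=
    (hα.contDiffOn_coframe.contDiffAt (hN.mem_nhds hx)).differentiableAt (by simp)
  have hM : HasFDerivAt (webMatrix α) _ x :=
    hW.hasFDerivAt.clm_comp (hasFDerivAt_const (inLast 𝕜 q r) x)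
  have h1 := hM.clm_apply (hκ.hasFDerivAt.clm_apply (hasFDerivAt_const V x))
  have h2 := (hW.hasFDerivAt.clm_apply
    (hasFDerivAt_const (tensorJ a⁻¹ a₀⁻¹ V) x)).const_smul a₀
  have h3 := h1.unique (h2.congr_of_eventuallyEq (Filter.mem_of_superset (hN.mem_nhds hx)
    fun y hy => hα.webMatrix_coframe hy V))
  have h4 := congrArg (fun L => L X) h3
  simp [hV] at h4
  rw [h4]
  congr 1
  funext k
  have h5 := (ContinuousLinearMap.proj (R := 𝕜) (φ := fun _ : Fin r => 𝕜) k).hasFDerivAt.comp x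
    (hW.hasFDerivAt.clm_apply (hasFDerivAt_const (tensorJ a⁻¹ a₀⁻¹ V) x))
  have hd : DifferentiableAt 𝕜 (α k) x :=
    ((hα.smooth k).contDiffAt (hN.mem_nhds hx)).differentiableAt (by simp)
  have h6 := congrArg (fun L => L X)
    (h5.unique (hd.hasFDerivAt.clm_apply (hasFDerivAt_const (tensorJ a⁻¹ a₀⁻¹ V) x)))
  simpa using h6

theorem IsVeroneseWeb.fderiv_symm (hα : IsVeroneseWeb a a₀ α N) (hN : IsOpen N) (hx : x ∈ N)
    (k : Fin r) (X Y : NSpace 𝕜 q r) : fderiv 𝕜 (α k) x X Y = fderiv 𝕜 (α k) x Y X := by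
  have hd : DifferentiableAt 𝕜 (α k) x :=
    ((hα.smooth k).contDiffAt (hN.mem_nhds hx)).differentiableAt (by simp)
  rw [← sub_eq_zero, ← extDeriv_one_apply _ hd, hα.closed k x hx]
  rfl

theorem IsVeroneseWeb.fderiv_twisted (hα : IsVeroneseWeb a a₀ α N) (hN : IsOpen N) (hx : x ∈ N)
    (k : Fin r) {X Y : NSpace 𝕜 q r} (hX : ∀ k, α k x X = 0) (hY : ∀ k, α k x Y = 0) :
    fderiv 𝕜 (α k) x X (eig a a₀ * Y) = fderiv 𝕜 (α k) x Y (eig a a₀ * X) := by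
  have hd : DifferentiableAt 𝕜 (α k) x :=
    ((hα.smooth k).contDiffAt (hN.mem_nhds hx)).differentiableAt (by simp)
  have hd' : HasFDerivAt (fun x => α k x ∘L tensorJ a a₀) _ x :=
    hd.hasFDerivAt.clm_comp (hasFDerivAt_const (tensorJ a a₀) x)
  have h := (wedgeAll_eq_zero_iff (hα.indep x hx) _).1 (hα.twisted_closed k x hx) ![X, Y]
    (fun i => by fin_cases i; exacts [mem_commonKer.2 hX, mem_commonKer.2 hY])
  rw [extDeriv_one_apply _ hd'.differentiableAt, hd'.fderiv, sub_eq_zero] at h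
  simpa [tensorJ_apply] using h

theorem IsVeroneseWeb.isAdapted_eig (hα : IsVeroneseWeb a a₀ α N) (hN : IsOpen N) :
    IsAdapted (coframe a a₀ α) (eig a a₀) a₀ N where
  smooth := hα.contDiffOn_coframe
  normalised _ hx := hα.coframe_normalised hx
  last _ := rfl
  integrable x hx X Y hX hY := by
    apply hα.webMatrix_injective hx
    rw [hα.webMatrix_fderiv_coframe hN hx X hY, hα.webMatrix_fderiv_coframe hN hx Y hX]
    simp only [hα.tensorJ_inv_apply, hα.fderiv_symm hN hx _ X Y]

theorem IsVeroneseWeb.isAdapted_one (hα : IsVeroneseWeb a a₀ α N) (hN : IsOpen N) :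
    IsAdapted (coframe a a₀ α) 1 1 N where
  smooth := hα.contDiffOn_coframe
  normalised _ hx := hα.coframe_normalised hx
  last _ := rfl
  integrable x hx X Y hX hY := by
    rw [one_mul] at hX hY
    rw [one_mul, one_mul]
    apply hα.webMatrix_injective hx
    rw [hα.webMatrix_fderiv_coframe hN hx X hY, hα.webMatrix_fderiv_coframe hN hx Y hX]
    rw [hα.coframe_eq_zero_iff hx] at hX hY
    congr 1
    funext k
    have h := hα.fderiv_twisted hN hx k hX hY
    rw [hα.eig_mul_tensorJ_inv, hα.eig_mul_tensorJ_inv] at h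
    rw [hα.fderiv_symm hN hx, ← h, hα.fderiv_symm hN hx]

end Coframe

/-! ### Poisson structures obtained by reduction -/

section Reduces

variable {𝕜 : Type*} [RCLike 𝕜] {q r m : ℕ} {N : Set (NSpace 𝕜 q r)}
  {M : Set (MSpace 𝕜 q r m)}
  {κ : NSpace 𝕜 q r → (NSpace 𝕜 q r →L[𝕜] (Fin r → 𝕜))}

/-- `R` is a smooth field of bivectors on `M × 𝕜^r` that `reduction κ` carries to `Λ`. -/
structure Reduces (κ : NSpace 𝕜 q r → (NSpace 𝕜 q r →L[𝕜] (Fin r → 𝕜)))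
    (M : Set (MSpace 𝕜 q r m)) (R : TSpace 𝕜 q r m → (TSpace 𝕜 q r m →L[𝕜] 𝕜) →L[𝕜] TSpace 𝕜 q r m)
    (Λ : MSpace 𝕜 q r m → (MSpace 𝕜 q r m →L[𝕜] 𝕜) →L[𝕜] MSpace 𝕜 q r m) : Prop where
  smooth : ∀ p : TSpace 𝕜 q r m, p.1 ∈ M → ContDiffAt 𝕜 ∞ R p
  skew : ∀ p : TSpace 𝕜 q r m, p.1 ∈ M → ∀ ξ ζ : TSpace 𝕜 q r m →L[𝕜] 𝕜,
    ζ (R p ξ) = -ξ (R p ζ)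
  related : ∀ p : TSpace 𝕜 q r m, p.1 ∈ M → Λ (reduction κ p) =
    fderiv 𝕜 (reduction κ) p ∘L R p ∘L
      ContinuousLinearMap.precomp 𝕜 (fderiv 𝕜 (reduction κ) p)

theorem Reduces.add {R R' : TSpace 𝕜 q r m → (TSpace 𝕜 q r m →L[𝕜] 𝕜) →L[𝕜] TSpace 𝕜 q r m}
    {Λ Λ' : MSpace 𝕜 q r m → (MSpace 𝕜 q r m →L[𝕜] 𝕜) →L[𝕜] MSpace 𝕜 q r m}
    (h : Reduces κ M R Λ) (h' : Reduces κ M R' Λ') :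
    Reduces κ M (fun p => R p + R' p) (fun p => Λ p + Λ' p) where
  smooth p hp := (h.smooth p hp).add (h'.smooth p hp)
  skew p hp ξ ζ := by
    simp only [add_apply, map_add, h.skew p hp ξ ζ, h'.skew p hp ξ ζ]
    ring
  related p hp := by
    rw [h.related p hp, h'.related p hp, ContinuousLinearMap.add_comp,
      ContinuousLinearMap.comp_add]

/-- `Λ` is Poisson exactly when the Jacobiator of `R` over `M × {0}` vanishes on the covectors
pulled back by `reduction κ`. -/
theorem Reduces.isPoissonOn_iff
    {R : TSpace 𝕜 q r m → (TSpace 𝕜 q r m →L[𝕜] 𝕜) →L[𝕜] TSpace 𝕜 q r m}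
    {Λ : MSpace 𝕜 q r m → (MSpace 𝕜 q r m →L[𝕜] 𝕜) →L[𝕜] MSpace 𝕜 q r m}
    (h : Reduces κ M R Λ) (hM : IsOpen M) (hκ : ∀ p ∈ M, ContDiffAt 𝕜 ∞ κ p.1) :
    IsPoissonOn Λ M ↔ ∀ p ∈ M, ∀ ξ ζ θ : MSpace 𝕜 q r m →L[𝕜] 𝕜,
      jacobiator R (inclM p) (ξ ∘L fderiv 𝕜 (reduction κ) (inclM p))
        (ζ ∘L fderiv 𝕜 (reduction κ) (inclM p)) (θ ∘L fderiv 𝕜 (reduction κ) (inclM p)) = 0 := by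
  have hΛ : ∀ p ∈ M, Λ p = fderiv 𝕜 (reduction κ) (inclM p) ∘L R (inclM p) ∘L
      ContinuousLinearMap.precomp 𝕜 (fderiv 𝕜 (reduction κ) (inclM p)) := fun p hp => by
    have h1 := h.related (inclM p) hp
    rwa [reduction_inclM] at h1
  have hred : ∀ p ∈ M, ContDiffAt 𝕜 ∞ (reduction κ) (inclM p : TSpace 𝕜 q r m) := fun p hp =>
    contDiffAt_reduction (p := inclM p) (hκ p hp)
  have smooth : ContDiffOn 𝕜 ∞ Λ M := by
    intro p hp
    have h1 : ContDiffAt 𝕜 ∞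
        (fun p : MSpace 𝕜 q r m => fderiv 𝕜 (reduction (m := m) κ) (inclM p)) p :=
      ContDiffAt.comp p ((hred p hp).fderiv_right (m := ∞) (by simp))
        (inclM : MSpace 𝕜 q r m →L[𝕜] TSpace 𝕜 q r m).contDiff.contDiffAt
    have h2 : ContDiffAt 𝕜 ∞ (fun p : MSpace 𝕜 q r m => R (inclM p)) p :=
      ContDiffAt.comp p (h.smooth _ hp)
        (inclM : MSpace 𝕜 q r m →L[𝕜] TSpace 𝕜 q r m).contDiff.contDiffAt
    have h3 : ContDiffAt 𝕜 ∞ (fun p : MSpace 𝕜 q r m =>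
        (ContinuousLinearMap.compL 𝕜 (TSpace 𝕜 q r m) (MSpace 𝕜 q r m) 𝕜).flip
          (fderiv 𝕜 (reduction κ) (inclM p))) p :=
      ContDiffAt.comp p (ContinuousLinearMap.contDiff _).contDiffAt h1
    exact ((h1.clm_comp (h2.clm_comp h3)).contDiffWithinAt).congr hΛ (hΛ p hp)
  have skew : ∀ p ∈ M, ∀ ξ ζ : MSpace 𝕜 q r m →L[𝕜] 𝕜, ζ (Λ p ξ) = -ξ (Λ p ζ) := by
    intro p hp ξ ζ
    rw [hΛ p hp]
    exact h.skew (inclM p) hp (ξ ∘L fderiv 𝕜 (reduction κ) (inclM p))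
      (ζ ∘L fderiv 𝕜 (reduction κ) (inclM p))
  rw [VeroneseModel.isPoissonOn_iff hM smooth skew]
  refine forall₂_congr fun p hp => forall₃_congr fun ξ ζ θ => ?_
  have hev : ∀ᶠ p' in 𝓝 (inclM p : TSpace 𝕜 q r m), p'.1 ∈ M :=
    continuous_fst.continuousAt (hM.mem_nhds hp)
  have h1 := jacobiator_of_related (Λ := Λ) (hred p hp)
    ((h.smooth _ hp).differentiableAt (by simp))
    (by
      rw [reduction_inclM]
      exact (smooth.contDiffAt (hM.mem_nhds hp)).differentiableAt (by simp))
    (h.skew _ hp) (hev.mono fun p' hp' ξ => by rw [h.related p' hp']; rfl) ξ ζ θ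
  rw [reduction_inclM] at h1
  rw [h1]

theorem contDiffAt_modelForm (b : Fin q ⊕ Fin r → 𝕜)
    {γ : PSpace 𝕜 q r m → PSpace 𝕜 q r m [⋀^Fin 2]→L[𝕜] 𝕜} {p : TSpace 𝕜 q r m}
    (hγ : ContDiffAt 𝕜 ∞ γ (projP (projM p))) : ContDiffAt 𝕜 ∞ (modelForm b γ) p := by
  have h1 : ContDiffAt 𝕜 ∞ (fun p : TSpace 𝕜 q r m => γ (projP (projM p))) p :=
    ContDiffAt.comp p hγ
      (projP ∘L projM : TSpace 𝕜 q r m →L[𝕜] PSpace 𝕜 q r m).contDiff.contDiffAt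
  have h2 : ContDiffAt 𝕜 ∞ (fun p : TSpace 𝕜 q r m =>
      ContinuousAlternatingMap.compContinuousLinearMapCLM (ι := Fin 2) (F := 𝕜)
        (projP ∘L projM : TSpace 𝕜 q r m →L[𝕜] PSpace 𝕜 q r m) (γ (projP (projM p)))) p :=
    ContDiffAt.comp p (ContinuousLinearMap.contDiff (𝕜 := 𝕜)
      (E := PSpace 𝕜 q r m [⋀^Fin 2]→L[𝕜] 𝕜) (F := TSpace 𝕜 q r m [⋀^Fin 2]→L[𝕜] 𝕜) _).contDiffAt h1
  exact contDiffAt_const.add h2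

theorem eventually_nondeg {b : Fin q ⊕ Fin r → 𝕜}
    {γ : PSpace 𝕜 q r m → PSpace 𝕜 q r m [⋀^Fin 2]→L[𝕜] 𝕜} (hM : IsOpen M)
    (hnd : ∀ p : TSpace 𝕜 q r m, p.1 ∈ M → Nondeg (modelForm b γ p)) {p : TSpace 𝕜 q r m}
    (hp : p.1 ∈ M) : ∀ᶠ p' in 𝓝 p, Nondeg (modelForm b γ p') :=
  Filter.Eventually.mono (continuous_fst.continuousAt (hM.mem_nhds hp)) hnd

/-- The bivector given by the `1`-forms `κ_l ∘ diag b` and the restriction of `modelForm b γ` to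
`M` is the reduction of the inverse of `modelForm b γ`. -/
theorem IsAdapted.reduces {b : Fin q ⊕ Fin r → 𝕜} {c : 𝕜} (h : IsAdapted κ b c N) (hN : IsOpen N)
    (hMN : Set.MapsTo projN M N) {γ : PSpace 𝕜 q r m → PSpace 𝕜 q r m [⋀^Fin 2]→L[𝕜] 𝕜}
    (hγ : ∀ p ∈ M, ContDiffAt 𝕜 ∞ γ (projP p))
    (hnd : ∀ p : TSpace 𝕜 q r m, p.1 ∈ M → Nondeg (modelForm b γ p)) {s : ℕ}
    {η : MSpace 𝕜 q r m → Fin s → MSpace 𝕜 q r m →L[𝕜] 𝕜}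
    (hη : ∀ p : MSpace 𝕜 q r m, p.1 ∈ N → ∀ v, v ∈ commonKer (η p) ↔ κ p.1 (b * v.1) = 0) :
    Reduces κ M (fun p => sharp (modelForm b γ p)) (fun p =>
      leafSharp (η p) ((modelForm b γ (inclM p)).compContinuousLinearMap inclM)) where
  smooth p hp := contDiffAt_sharp (contDiffAt_modelForm b (hγ p.1 hp)) (hnd p hp)
  skew p hp := sharp_skew (hnd p hp)
  related p hp := by
    have h1 : (reduction κ p).1 = p.1.1 := by simp [reduction, embY, projM, projN]
    exact leafSharp_eq_reduction h hN (hMN hp) (hnd p hp) fun v => by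
      have h2 := hη (reduction κ p) (by rw [h1]; exact hMN hp) v
      rwa [h1] at h2

end Reduces

/-! ### Compatibility of the two Poisson structures -/

section Main

variable {𝕜 : Type*} [RCLike 𝕜] {q r m : ℕ}

variable (𝕜 q r m) in
/-- The form `∑ dz_{2k-1} ∧ dz_{2k}` on `P`. -/
def formZ : PSpace 𝕜 q r m [⋀^Fin 2]→L[𝕜] 𝕜 :=
  ∑ k, wedgeOne (ContinuousLinearMap.proj (k, 0) ∘L ContinuousLinearMap.snd 𝕜 _ _)
    (oneForm (ContinuousLinearMap.proj (k, 1) ∘L ContinuousLinearMap.snd 𝕜 _ _))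

theorem flat_formZ (X Y : PSpace 𝕜 q r m) : flat (formZ 𝕜 q r m) X Y =
    ∑ k, (X.2 (k, 0) * Y.2 (k, 1) - X.2 (k, 1) * Y.2 (k, 0)) := by
  rw [formZ, flat_sum_apply]
  exact Finset.sum_congr rfl fun _ _ => flat_wedgeOne _ _ _ _

theorem formΩ_eq (p : TSpace 𝕜 q r m) : formΩ p = modelForm 1 (fun _ => formZ 𝕜 q r m) p := by
  refine ext_flat fun X Y => ?_
  rw [flat_modelForm, flat_formZ, formΩ, flat_add_apply, flat_sum_apply, flat_sum_apply,
    Fintype.sum_sum_type]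
  simp only [Pi.one_apply, one_mul]
  exact congrArg₂ (· + ·) (congrArg₂ (· + ·)
    (Finset.sum_congr rfl fun _ _ => flat_wedgeOne _ _ _ _)
    (Finset.sum_congr rfl fun _ _ => flat_wedgeOne _ _ _ _))
    (Finset.sum_congr rfl fun _ _ => flat_wedgeOne _ _ _ _)

theorem nondeg_formΩ (p : TSpace 𝕜 q r m) :
    Nondeg (modelForm 1 (fun _ => formZ 𝕜 q r m) p) := by
  intro X hX
  have h : ∀ Y, _ = (0 : 𝕜) := fun Y =>
    (flat_modelForm 1 (fun _ => formZ 𝕜 q r m) p X Y).symm.trans ((flat_apply _ _ _).trans (hX Y))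
  simp only [flat_formZ, Pi.one_apply, one_mul] at h
  have hx : X.1.1 = 0 := by
    funext j
    rcases j with j | j
    · simpa [Pi.single_apply] using h ((0, Pi.single j 1, 0), 0)
    · simpa [Pi.single_apply] using h ((0, 0, 0), Pi.single j 1)
  have hy : X.1.2.1 = 0 := by
    funext j
    simpa [Pi.single_apply] using h ((Pi.single (Sum.inl j) 1, 0, 0), 0)
  have hy' : X.2 = 0 := by
    funext j
    simpa [Pi.single_apply] using h ((Pi.single (Sum.inr j) 1, 0, 0), 0)
  have hz : X.1.2.2 = 0 := by
    funext ⟨k, e⟩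
    fin_cases e
    · simpa [Pi.single_apply] using h ((0, 0, Pi.single (k, 1) 1), 0)
    · simpa [Pi.single_apply] using h ((0, 0, Pi.single (k, 0) 1), 0)
  ext : 1
  · ext : 1
    · exact hx
    · exact Prod.ext hy hz
  · exact hy'

/-- `Ω₂` does not depend on the coordinates `y_{n-r+1}, …, y_n`. -/
theorem extDeriv_formΩ₂ (a : Fin q → 𝕜) (a₀ : 𝕜)
    (β : PSpace 𝕜 q r m → PSpace 𝕜 q r m [⋀^Fin 2]→L[𝕜] 𝕜) (p : TSpace 𝕜 q r m) :
    extDeriv (formΩ₂ a a₀ β) p = extDeriv (formΩ₂ a a₀ β) (inclM (projM p)) := by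
  have h1 := fderiv_comp_add_right (𝕜 := 𝕜) (f := formΩ₂ a a₀ β) (x := p) (-(0, p.2))
  have h2 : (fun x => formΩ₂ a a₀ β (x + -(0, p.2))) = formΩ₂ a a₀ β := by
    funext x
    have h3 : projM (x + -(0, p.2)) = projM x := by simp [projM]
    simp only [formΩ₂, formΩ₁, h3]
    rfl
  have h4 : p + -(0, p.2) = inclM (projM p) := by
    ext <;> simp [inclM, projM]
  rw [h2, h4] at h1
  rw [extDeriv, extDeriv, h1]

end Main

end VeroneseModel

end

theorem proposition1p1 {𝕜 : Type*} [RCLike 𝕜] (q r m : ℕ)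
    (N : Set (VeroneseModel.NSpace 𝕜 q r)) (hN : IsOpen N)
    (P : Set (VeroneseModel.PSpace 𝕜 q r m)) (hP : IsOpen P)
    (M : Set (VeroneseModel.MSpace 𝕜 q r m)) (hM : IsOpen M)
    (hMN : Set.MapsTo VeroneseModel.projN M N) (hMP : Set.MapsTo VeroneseModel.projP M P)
    (a : Fin q → 𝕜) (a₀ : 𝕜)
    (α : Fin r → VeroneseModel.NSpace 𝕜 q r → (VeroneseModel.NSpace 𝕜 q r →L[𝕜] 𝕜))
    (hα : VeroneseModel.IsVeroneseWeb a a₀ α N)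
    (β : VeroneseModel.PSpace 𝕜 q r m → VeroneseModel.PSpace 𝕜 q r m [⋀^Fin 2]→L[𝕜] 𝕜)
    (hβ : ContDiffOn 𝕜 ∞ β P)
    (hclosed : ∀ p ∈ M ×ˢ (Set.univ : Set (Fin r → 𝕜)),
      extDeriv (VeroneseModel.formΩ₁ a a₀ β) p = 0)
    (hnondeg : ∀ p ∈ M ×ˢ (Set.univ : Set (Fin r → 𝕜)),
      VeroneseModel.Nondeg (VeroneseModel.formΩ₁ a a₀ β p)) :
    VeroneseModel.IsPoissonOn (VeroneseModel.bivectorΛ a a₀ α) M ∧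
    VeroneseModel.IsPoissonOn (VeroneseModel.bivectorΛ₁ a a₀ α β) M ∧
    (VeroneseModel.IsPoissonOn
        (fun p => VeroneseModel.bivectorΛ a a₀ α p + VeroneseModel.bivectorΛ₁ a a₀ α β p) M ↔
      ∀ p ∈ M ×ˢ (Set.univ : Set (Fin r → 𝕜)),
        VeroneseModel.wedgeAll r
          (fun k => α k (VeroneseModel.projN (VeroneseModel.projM p)) ∘L
            VeroneseModel.projN ∘L VeroneseModel.projM)
          (extDeriv (VeroneseModel.formΩ₂ a a₀ β) p) = 0) := by
  open VeroneseModel in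
  have hΩ₁ : formΩ₁ a a₀ β = modelForm (eig a a₀) β := rfl
  rw [hΩ₁] at hclosed hnondeg
  have hnd : ∀ p : TSpace 𝕜 q r m, p.1 ∈ M → Nondeg (modelForm (eig a a₀) β p) := fun p hp =>
    hnondeg p ⟨hp, trivial⟩
  have hcl : ∀ p ∈ M, extDeriv (modelForm (eig a a₀) β) (inclM p) = 0 := fun p hp =>
    hclosed (inclM p) ⟨hp, trivial⟩
  have hβ' : ∀ p ∈ M, ContDiffAt 𝕜 ∞ β (projP p) := fun p hp =>
    hβ.contDiffAt (hP.mem_nhds (hMP hp))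
  have hA := hα.isAdapted_one hN
  have hA₁ := hα.isAdapted_eig hN
  have hκ : ∀ p ∈ M, ContDiffAt 𝕜 ∞ (coframe a a₀ α) p.1 := fun p hp =>
    hA.contDiffAt hN (hMN hp)
  -- The form `Ω` is constant.
  let σ : TSpace 𝕜 q r m [⋀^Fin 2]→L[𝕜] 𝕜 := modelForm 1 (fun _ => formZ 𝕜 q r m) 0
  have hσ : Nondeg σ := nondeg_formΩ 0
  have hR : Reduces (coframe a a₀ α) M (fun _ => sharp σ) (bivectorΛ a a₀ α) := by
    have h := hA.reduces hN hMN (γ := fun _ => formZ 𝕜 q r m) (fun _ _ => contDiffAt_const)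
      (fun p _ => nondeg_formΩ p)
      (η := fun p k => α k (projN p) ∘L (tensorJ a a₀).inverse ∘L projN) (fun p hp v => by
        rw [mem_commonKer, one_mul, hα.coframe_eq_zero_iff hp, hα.inverse_tensorJ]
        rfl)
    have hΛ : bivectorΛ (m := m) a a₀ α = fun p =>
        leafSharp (fun k => α k (projN p) ∘L (tensorJ a a₀).inverse ∘L projN)
          ((modelForm 1 (fun _ => formZ 𝕜 q r m) (inclM p)).compContinuousLinearMap inclM) := by
      funext p
      rw [bivectorΛ, formΩ_eq]
    rw [hΛ]
    exact h
  have hR₁ : Reduces (coframe a a₀ α) M (fun p => sharp (modelForm (eig a a₀) β p))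
      (bivectorΛ₁ a a₀ α β) :=
    hA₁.reduces hN hMN hβ' hnd (η := fun p k => α k (projN p) ∘L projN) (fun p hp v => by
        rw [mem_commonKer, hα.coframe_eq_zero_iff hp, hα.tensorJ_inv_apply]
        rfl)
  have hC : ∀ p ∈ M, ContDiffAt 𝕜 1 (modelForm (eig a a₀) β) (inclM p) := fun p hp =>
    (contDiffAt_modelForm (eig a a₀) (hβ' p hp)).of_le (by simp)
  refine ⟨(hR.isPoissonOn_iff hM hκ).2 fun p hp ξ ζ θ => ?_,
    (hR₁.isPoissonOn_iff hM hκ).2 fun p hp ξ ζ θ => ?_, ?_⟩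
  · have h0 : fderiv 𝕜 (fun _ : TSpace 𝕜 q r m => sharp σ) (inclM p) = 0 :=
      fderiv_const_apply (𝕜 := 𝕜) (E := TSpace 𝕜 q r m)
        (F := (TSpace 𝕜 q r m →L[𝕜] 𝕜) →L[𝕜] TSpace 𝕜 q r m) (sharp σ)
    simp only [jacobiator, h0, zero_apply, map_zero, add_zero]
  · rw [jacobiator_sharp (hC p hp) (eventually_nondeg hM hnd hp), hcl p hp]
    simp
  · rw [(hR.add hR₁).isPoissonOn_iff hM hκ]
    have hΩ₂ : formΩ₂ a a₀ β = fun p => secondForm σ (modelForm (eig a a₀) β p) := by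
      funext p
      rw [formΩ₂, formΩ_eq]
      rfl
    have hJ := fun p (hp : p ∈ M) => jacobiator_sharp_add hσ (hC p hp)
      (eventually_nondeg hM hnd hp) (hcl p hp)
    rw [← hΩ₂] at hJ
    have hind : ∀ p : TSpace 𝕜 q r m, p.1 ∈ M →
        LinearIndependent 𝕜 (fun k => α k (projN (projM p)) ∘L projN ∘L
          (projM : TSpace 𝕜 q r m →L[𝕜] MSpace 𝕜 q r m)) := fun p hp =>
      (hα.indep _ (hMN hp)).map' (ContinuousLinearMap.precomp 𝕜
          (projN ∘L projM : TSpace 𝕜 q r m →L[𝕜] NSpace 𝕜 q r)).toLinearMap <| by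
        rw [LinearMap.ker_eq_bot']
        intro ξ hξ
        ext1 v
        exact congrArg (fun L => L ((v, 0, 0), 0)) hξ
    have hzero : ∀ p ∈ M, ∀ v : NSpace 𝕜 q r,
        coframe a a₀ α p.1 (eig a a₀ * v) = 0 ↔ ∀ k, α k p.1 v = 0 := fun p hp v => by
      rw [hα.coframe_eq_zero_iff (x := p.1) (hMN hp), hα.tensorJ_inv_apply]
    constructor
    · intro h p hp
      rw [extDeriv_formΩ₂, wedgeAll_eq_zero_iff (hind p hp.1)]
      intro v hv
      simp only [mem_commonKer] at hv
      have hX : ∀ i, ∃ ξ : MSpace 𝕜 q r m →L[𝕜] 𝕜,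
          sharp (modelForm (eig a a₀) β (inclM (projM p)))
            (ξ ∘L fderiv 𝕜 (reduction (coframe a a₀ α)) (inclM (projM p))) = v i := fun i =>
        hA₁.exists_sharp_eq hN (hMN hp.1) (hnd _ hp.1) ((hzero p.1 hp.1 _).2 (hv i))
      choose ξ hξ using hX
      have h1 := h (projM p) hp.1 (ξ 0) (ξ 1) (ξ 2)
      rw [hJ (projM p) hp.1, hξ, hξ, hξ] at h1
      rw [← h1]
      congr 1
      funext i
      fin_cases i <;> rfl
    · intro h p hp ξ ζ θ
      rw [hJ p hp]
      have h1 := h (inclM p) ⟨hp, trivial⟩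
      rw [wedgeAll_eq_zero_iff (hind (inclM p) hp)] at h1
      refine h1 _ fun i => mem_commonKer.2 ?_
      have h2 : ∀ ξ : MSpace 𝕜 q r m →L[𝕜] 𝕜, ∀ k, α k p.1
          (sharp (modelForm (eig a a₀) β (inclM p))
            (ξ ∘L fderiv 𝕜 (reduction (coframe a a₀ α)) (inclM p))).1.1 = 0 := fun ξ =>
        (hzero p hp _).1 (hA₁.apply_sharp_eq_zero hN (p := inclM p) (hMN hp)
          (hnd (inclM p) hp) ξ)
      fin_cases i
      exacts [h2 ξ, h2 ζ, h2 θ]
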